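/- Theorem 5.8. Let $T>0$. For $Q=[0,T]\times\mathbb R$, $Q=[0,T]\times\mathbb R\times\mathbb R$ or $Q=\mathbb R$, let $C^\infty(Q)$ be the space of real functions that are smooth on $Q$ (up to the boundary), with the topology of uniform convergence of all derivatives on compact subsets of $Q$, and identify $S^1$ with $\mathbb R/\mathbb Z$, so that $F=C^\infty([0,T]\times S^1)$, $E_0=C^\infty(S^1)$ and $E_1=C^\infty([0,T]\times S^1\times\mathbb R)$ are the topological linear subspaces of those functions which have period $1$ in the circle variable; $C^1([0,T]\times S^1)$ is defined similarly. Let $E=E_0\times E_1$ with the product topology. Let the solution relation $\Sigma$ of the transport equation $$y_t+y_\theta=\varphi(t,\theta,y(t,\theta)),\qquad y(0,\theta)=y_0(\theta)$$ on the compact cylinder $[0,T]\times S^1$ be the set of all $(y_0,\varphi,y)\in E_0\times E_1\times C^1([0,T]\times S^1)$ such that $$y(t,\eta)=y_0(\eta-t)+\int_0^t\varphi\bigl(\tau,\eta-t+\tau,y(\tau,\eta-t+\tau)\bigr)\,d\tau\qquad\text{for all }t\in[0,T],\ \eta\in\mathbb R.$$ Then $\Sigma$ is a Keller $C^\infty_\Pi$-map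 from $E$ to $F$. That is: every $y$ occurring in $\Sigma$ belongs to $F$; $\Sigma$ is (the graph of) a function; its domain $U\subseteq E$ is open; and there are functions $d^l\Sigma$ ($l=0,1,2,\dots$) which assign to each $x\in U$ a continuous $l$-linear map $d^l\Sigma(x):E^l\to F$, such that $d^0\Sigma=\Sigma$, for all $l$, all $x\in U$ and all $u_1,\dots,u_l,h\in E$ $$d^{l+1}\Sigma(x)(u_1,\dots,u_l,h)=\lim_{t\to0}t^{-1}\bigl(d^l\Sigma(x+th)-d^l\Sigma(x)\bigr)(u_1,\dots,u_l),$$ and for all $l$, all $x\in U$ and every zero neighbourhood $W$ of $F$ there is a zero neighbourhood $N$ of $E$ such that for every $\varepsilon>0$ there is a zero neighbourhood $V$ of $E$ with $\bigl(d^l\Sigma(x+v)-d^l\Sigma(x)\bigr)(N^l)\subseteq\varepsilon W$ for all $v\in V$ with $x+v\in U$. -/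

import Mathlib

open Set Filter Topology
open scoped ContDiff

noncomputable section

/-! Keller smooth maps between real Hausdorff locally convex spaces. -/

section Keller

variable {E F : Type*}
  [AddCommGroup E] [Module ℝ E] [TopologicalSpace E] [IsTopologicalAddGroup E]
  [ContinuousSMul ℝ E] [LocallyConvexSpace ℝ E] [T2Space E]
  [AddCommGroup F] [Module ℝ F] [TopologicalSpace F] [IsTopologicalAddGroup F]
  [ContinuousSMul ℝ F] [LocallyConvexSpace ℝ F] [T2Space F]

/-- `D` is the sequence of differentials, on the set `U`, of the function `x ↦ D 0 x ![]`, and it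
satisfies the continuity condition of Keller's class `C_Π^∞`. The differential `D (l + 1) x` is
obtained from `D l` by taking the directional derivative in the last argument (as `F` is Hausdorff,
on an open `U` all differentials are determined by `D 0`), each differential is a continuous
multilinear map, and `x ↦ D l x` is continuous in Keller's sense: in that condition the
neighbourhood `N` of zero is chosen before `ε`. -/
structure IsKellerSeriesOn (U : Set E)
    (D : (l : ℕ) → E → ContinuousMultilinearMap ℝ (fun _ : Fin l => E) F) : Prop where
  tendsto_variation : ∀ (l : ℕ), ∀ x ∈ U, ∀ (u : Fin l → E) (h : E),
    Tendsto (fun t : ℝ => t⁻¹ • (D l (x + t • h) u - D l x u)) (𝓝[≠] 0)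
      (𝓝 (D (l + 1) x (Fin.snoc (α := fun _ => E) u h)))
  continuity : ∀ (l : ℕ), ∀ x ∈ U, ∀ W ∈ 𝓝 (0 : F), ∃ N ∈ 𝓝 (0 : E), ∀ ε : ℝ, 0 < ε →
    ∃ V ∈ 𝓝 (0 : E), ∀ v ∈ V, x + v ∈ U → ∀ u : Fin l → E, (∀ i, u i ∈ N) →
      ∃ w ∈ W, D l (x + v) u - D l x u = ε • w

/-- A relation `f ⊆ E × F` is a Keller smooth map (a member of `C_Π^∞`): it is (the graph of) a
function on an open subset `U` of `E`, with values in `F`, having differentials of all orders on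
`U` which are continuous in Keller's sense. -/
def IsKellerSmooth (f : Set (E × F)) : Prop :=
  ∃ (U : Set E) (D : (l : ℕ) → E → ContinuousMultilinearMap ℝ (fun _ : Fin l => E) F),
    IsOpen U ∧ f = {w | w.1 ∈ U ∧ w.2 = D 0 w.1 ![]} ∧ IsKellerSeriesOn U D

end Keller

/-! Spaces of differentiable functions. -/

section Spaces

variable {V : Type*} [NormedAddCommGroup V] [NormedSpace ℝ V]

/-- The space of `C^n` functions `Q → ℝ`, periodic with period `p`. A function on `Q` is
represented by its extension by zero to the whole space, and derivatives are taken within `Q`. -/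
def PeriodicCk (n : ℕ∞) (Q : Set V) (p : V) : Submodule ℝ (V → ℝ) where
  carrier := {f | ContDiffOn ℝ n f Q ∧ (∀ x ∉ Q, f x = 0) ∧ ∀ x, f (x + p) = f x}
  add_mem' := fun {f g} hf hg =>
    ⟨hf.1.add hg.1, fun x hx => by simp [hf.2.1 x hx, hg.2.1 x hx],
      fun x => by simp [hf.2.2 x, hg.2.2 x]⟩
  zero_mem' := ⟨contDiffOn_const, fun _ _ => rfl, fun _ => rfl⟩
  smul_mem' := fun c f hf =>
    ⟨hf.1.const_smul c, fun x hx => by simp [hf.2.1 x hx], fun x => by simp [hf.2.2 x]⟩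

/-- The space of smooth functions `Q → ℝ` with period `p`. It is a type of its own (not a reducible
synonym of the submodule), since it does not carry the topology of pointwise convergence. -/
def SmoothSpace (Q : Set V) (p : V) : Type _ := ↥(PeriodicCk ⊤ Q p)

namespace SmoothSpace

variable {Q : Set V} {p : V}

instance : AddCommGroup (SmoothSpace Q p) := inferInstanceAs (AddCommGroup ↥(PeriodicCk ⊤ Q p))

instance : Module ℝ (SmoothSpace Q p) := inferInstanceAs (Module ℝ ↥(PeriodicCk ⊤ Q p))

instance : CoeFun (SmoothSpace Q p) (fun _ => V → ℝ) := ⟨fun f => f.1⟩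

theorem contDiffOn (f : SmoothSpace Q p) : ContDiffOn ℝ ∞ f Q := f.2.1

theorem coe_add (f g : SmoothSpace Q p) : ⇑(f + g) = (f : V → ℝ) + g := rfl

theorem coe_smul (c : ℝ) (f : SmoothSpace Q p) : ⇑(c • f) = c • (f : V → ℝ) := rfl

theorem coe_zero : ⇑(0 : SmoothSpace Q p) = 0 := rfl

/-- A smooth function is in particular of class `C^1`. -/
def toC1 (f : SmoothSpace Q p) : ↥(PeriodicCk 1 Q p) :=
  ⟨f, f.contDiffOn.of_le (by exact_mod_cast (le_top : (1 : ℕ∞) ≤ ⊤)), f.2.2⟩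

variable [hQ : Fact (UniqueDiffOn ℝ Q)]

theorem bddAbove (f : SmoothSpace Q p) (m : ℕ) {K : Set V} (hK : IsCompact K) (hKQ : K ⊆ Q) :
    BddAbove (range fun x : K => ‖iteratedFDerivWithin ℝ m f Q x‖) := by
  have hc : ContinuousOn (fun x => ‖iteratedFDerivWithin ℝ m f Q x‖) K :=
    ((f.contDiffOn.continuousOn_iteratedFDerivWithin
      (by exact_mod_cast (le_top : (m : ℕ∞) ≤ ⊤)) hQ.out).mono hKQ).norm
  have := hK.bddAbove_image hc
  rwa [image_eq_range] at this

/-- The seminorm `f ↦ sup_{x ∈ K} ‖D^m f (x)‖`, for a compact `K ⊆ Q` and an order `m`. -/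
def seminorm (i : ℕ × {K : Set V // IsCompact K ∧ K ⊆ Q}) : Seminorm ℝ (SmoothSpace Q p) :=
  Seminorm.of (fun f => ⨆ x : i.2.1, ‖iteratedFDerivWithin ℝ i.1 f Q x‖)
    (fun f g => by
      refine Real.iSup_le (fun x => ?_)
        (add_nonneg (Real.iSup_nonneg fun _ => norm_nonneg _)
          (Real.iSup_nonneg fun _ => norm_nonneg _))
      have hx := i.2.2.2 x.2
      have hle : ((i.1 : ℕ∞) : WithTop ℕ∞) ≤ ∞ := by
        exact_mod_cast (le_top : (i.1 : ℕ∞) ≤ ⊤)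
      rw [coe_add, iteratedFDerivWithin_add_apply ((f.contDiffOn x hx).of_le hle)
        ((g.contDiffOn x hx).of_le hle) hQ.out hx]
      exact (norm_add_le _ _).trans
        (add_le_add (le_ciSup (f.bddAbove i.1 i.2.2.1 i.2.2.2) x)
          (le_ciSup (g.bddAbove i.1 i.2.2.1 i.2.2.2) x)))
    (fun c f => by
      rw [Real.mul_iSup_of_nonneg (norm_nonneg c)]
      congr 1
      funext x
      have hx := i.2.2.2 x.2
      have hle : ((i.1 : ℕ∞) : WithTop ℕ∞) ≤ ∞ := by
        exact_mod_cast (le_top : (i.1 : ℕ∞) ≤ ⊤)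
      rw [coe_smul, iteratedFDerivWithin_const_smul_apply
        ((f.contDiffOn x hx).of_le hle) hQ.out hx, norm_smul])

/-- The family of all the seminorms `sup_K ‖D^m f‖`. -/
def seminormFamily (Q : Set V) (p : V) [Fact (UniqueDiffOn ℝ Q)] :
    SeminormFamily ℝ (SmoothSpace Q p) (ℕ × {K : Set V // IsCompact K ∧ K ⊆ Q}) := seminorm

instance : Nonempty (ℕ × {K : Set V // IsCompact K ∧ K ⊆ Q}) :=
  ⟨0, ∅, isCompact_empty, empty_subset Q⟩

/-- The topology of uniform convergence of all derivatives on all compact subsets of `Q`. -/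
instance : TopologicalSpace (SmoothSpace Q p) :=
  (seminormFamily Q p).moduleFilterBasis.topology

theorem withSeminorms : WithSeminorms (seminormFamily Q p) := ⟨rfl⟩

instance : IsTopologicalAddGroup (SmoothSpace Q p) := withSeminorms.topologicalAddGroup

instance : ContinuousSMul ℝ (SmoothSpace Q p) := withSeminorms.continuousSMul

instance : LocallyConvexSpace ℝ (SmoothSpace Q p) := withSeminorms.toLocallyConvexSpace

instance : T2Space (SmoothSpace Q p) := by
  have : T1Space (SmoothSpace Q p) := by
    refine withSeminorms.T1_of_separating fun f hf => ?_
    have h : ∃ x, f x ≠ 0 := by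
      by_contra! h
      exact hf (Subtype.ext (funext h))
    obtain ⟨x, hx⟩ := h
    have hxQ : x ∈ Q := by
      by_contra hxQ
      exact hx (f.2.2.1 x hxQ)
    refine ⟨(0, ⟨{x}, isCompact_singleton, singleton_subset_iff.2 hxQ⟩), fun h0 => hx ?_⟩
    have h1 : ‖iteratedFDerivWithin ℝ 0 f Q x‖ ≤ 0 :=
      (le_ciSup (f.bddAbove 0 isCompact_singleton (singleton_subset_iff.2 hxQ))
        (⟨x, rfl⟩ : ({x} : Set V))).trans h0.le
    rw [norm_iteratedFDerivWithin_zero] at h1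
    exact norm_le_zero_iff.1 h1
  infer_instance

end SmoothSpace

end Spaces

/-! The transport equation on the compact cylinder. The circle is `ℝ / ℤ`. -/

/-- The strip `[0, T] × ℝ`, covering the cylinder `[0, T] × S¹`. -/
def strip (T : ℝ) : Set (ℝ × ℝ) := Icc 0 T ×ˢ univ

/-- The slab `[0, T] × ℝ × ℝ`, covering `[0, T] × S¹ × ℝ`. -/
def slab (T : ℝ) : Set (ℝ × ℝ × ℝ) := Icc 0 T ×ˢ univ

instance : Fact (UniqueDiffOn ℝ (univ : Set ℝ)) := ⟨uniqueDiffOn_univ⟩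

instance (T : ℝ) [hT : Fact (0 < T)] : Fact (UniqueDiffOn ℝ (strip T)) :=
  ⟨(uniqueDiffOn_Icc hT.out).prod uniqueDiffOn_univ⟩

instance (T : ℝ) [hT : Fact (0 < T)] : Fact (UniqueDiffOn ℝ (slab T)) :=
  ⟨(uniqueDiffOn_Icc hT.out).prod uniqueDiffOn_univ⟩

/-- `C^∞(S¹)`. -/
abbrev SmoothCircle : Type := SmoothSpace (univ : Set ℝ) 1

/-- `C^∞([0, T] × S¹)`. -/
abbrev SmoothCylinder (T : ℝ) : Type := SmoothSpace (strip T) (0, 1)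

/-- `C^∞([0, T] × S¹ × ℝ)`. -/
abbrev SmoothNonlinearity (T : ℝ) : Type := SmoothSpace (slab T) (0, 1, 0)

/-- `C^1([0, T] × S¹)`. -/
abbrev C1Cylinder (T : ℝ) : Type := ↥(PeriodicCk 1 (strip T) (0, 1))

/-- The solution relation of the initial value problem `y_t + y_θ = φ(t, θ, y)`, `y(0, ·) = y₀`:
the set of all `((y₀, φ), y)` with `y₀` and `φ` smooth and `y` of class `C^1` such that
`y(t, η) = y₀(η - t) + ∫₀ᵗ φ(τ, η - t + τ, y(τ, η - t + τ)) dτ` on `[0, T] × ℝ`. -/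
def solutionRelation (T : ℝ) :
    Set ((SmoothCircle × SmoothNonlinearity T) × C1Cylinder T) :=
  {w | ∀ t ∈ Icc 0 T, ∀ η : ℝ,
    w.2.1 (t, η) = w.1.1 (η - t) +
      ∫ τ in (0 : ℝ)..t, w.1.2 (τ, η - t + τ, w.2.1 (τ, η - t + τ))}

end

/-! Along each characteristic `τ ↦ (τ, ξ + τ)` the problem is a scalar ODE. By Hadamard's formula,
the difference of two solutions satisfies a linear equation whose coefficient is the mean slope of
the nonlinearity between them, and an integrating factor solves that equation explicitly
(`linSolution`). Writing `S` for the solution operator, `x = (k, φ)` and `h = (κ, ψ)`, this gives `S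
(x + t h) - S x = t * linSol κ (slope φ (S x) (S (x + t h))) (ψ (·, S (x + t h)))`. The factor of
`t` is a smooth operator applied to values of `S`. Hence, if `S` is of class `C^n`, so is its
difference quotient, including `t = 0`, and `S` is of class `C^(n+1)` (`quotDiffOn_solutionMap`). No
derivatives are lost and no inverse function theorem is needed.

The induction starts from the continuity of `S` on an open domain. Truncating the nonlinearity in
`z` and applying Gronwall's estimate gives solutions for nearby data, uniformly close to the given
one (`IsTransportSolution.eventually_exists`). The same difference identity, applied to a solution
and its translate in the circle variable, expresses the derivative of a solution through the values
of that solution (`IsTransportSolution.exists_angle_quotient`). Bootstrapping then gives smoothness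
of all solutions, and turns uniform closeness into closeness of all derivatives.

Two formalisms carry the argument. `ContDiffFamilyOn` replaces continuity of maps into function
spaces by joint continuity of derivatives; `SmoothSpace.contDiffFamilyOn_eval` and
`SmoothSpace.continuous_of_contDiffFamilyOn` translate in the two directions. `QuotDiffOn` describes
differentiability by continuous difference quotients, a notion stable under composition;
`isKellerSmooth_of_quotDiffOn` passes from it to Keller's class. -/

/-! Families of `C^m` functions, depending continuously on a parameter in a topological space. -/

section Families

universe u

variable {X X' : Type*} [TopologicalSpace X] [TopologicalSpace X']
  {V V' W W' W'' : Type u}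
  [NormedAddCommGroup V] [NormedSpace ℝ V] [NormedAddCommGroup V'] [NormedSpace ℝ V']
  [NormedAddCommGroup W] [NormedSpace ℝ W] [NormedAddCommGroup W'] [NormedSpace ℝ W']
  [NormedAddCommGroup W''] [NormedSpace ℝ W'']

/-- The functions `f x : V → W` are of class `C^m` on `Q`, and all their derivatives up to order
`m` are jointly continuous on `X × Q`. -/
def ContDiffFamilyOn (Q : Set V) : (m : ℕ) → {W : Type u} → [NormedAddCommGroup W] →
    [NormedSpace ℝ W] → (f : X → V → W) → Prop
  | 0, _, _, _, f => ContinuousOn (fun z : X × V => f z.1 z.2) (univ ×ˢ Q)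
  | m + 1, W, _, _, f => ContinuousOn (fun z : X × V => f z.1 z.2) (univ ×ˢ Q) ∧
      ∃ f' : X → V → V →L[ℝ] W, (∀ x, ∀ q ∈ Q, HasFDerivWithinAt (f x) (f' x q) Q q) ∧
        ContDiffFamilyOn Q m f'

namespace ContDiffFamilyOn

variable {Q : Set V} {Q' : Set V'} {m : ℕ}

theorem continuousOn {f : X → V → W} (h : ContDiffFamilyOn Q m f) :
    ContinuousOn (fun z : X × V => f z.1 z.2) (univ ×ˢ Q) := by
  cases m with
  | zero => exact h
  | succ m => exact h.1

theorem congr {f g : X → V → W} (h : ContDiffFamilyOn Q m f) (hfg : ∀ x, EqOn (g x) (f x) Q) :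
    ContDiffFamilyOn Q m g := by
  have h0 : ContinuousOn (fun z : X × V => g z.1 z.2) (univ ×ˢ Q) :=
    h.continuousOn.congr fun z hz => hfg z.1 hz.2
  cases m with
  | zero => exact h0
  | succ m =>
    obtain ⟨_, f', hf', h'⟩ := h
    exact ⟨h0, f', fun x q hq => (hf' x q hq).congr (hfg x) (hfg x hq), h'⟩

theorem of_succ {f : X → V → W} (h : ContDiffFamilyOn Q (m + 1) f) : ContDiffFamilyOn Q m f := by
  induction m generalizing W with
  | zero => exact h.1
  | succ m ih =>
    obtain ⟨h0, f', hf', h'⟩ := h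
    exact ⟨h0, f', hf', ih h'⟩

theorem const (c : W) : ContDiffFamilyOn Q m (fun (_ : X) (_ : V) => c) := by
  induction m generalizing W with
  | zero => exact continuousOn_const
  | succ m ih => exact ⟨continuousOn_const, _, fun _ _ _ => hasFDerivWithinAt_const _ _ _, ih 0⟩

theorem of_continuous {c : X → W} (hc : Continuous c) :
    ContDiffFamilyOn Q m (fun (x : X) (_ : V) => c x) := by
  have h0 : Continuous (fun z : X × V => c z.1) := hc.comp continuous_fst
  cases m with
  | zero => exact h0.continuousOn
  | succ m => exact ⟨h0.continuousOn, _, fun _ _ _ => hasFDerivWithinAt_const _ _ _, const 0⟩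

theorem of_clm (L : V →L[ℝ] W) : ContDiffFamilyOn Q m (fun (_ : X) (q : V) => L q) := by
  have h0 : Continuous (fun z : X × V => L z.2) := L.continuous.comp continuous_snd
  cases m with
  | zero => exact h0.continuousOn
  | succ m => exact ⟨h0.continuousOn, _, fun _ _ _ => L.hasFDerivWithinAt, const L⟩

theorem clm_comp (L : W →L[ℝ] W') {f : X → V → W} (h : ContDiffFamilyOn Q m f) :
    ContDiffFamilyOn Q m (fun x q => L (f x q)) := by
  induction m generalizing W W' with
  | zero => exact L.continuous.comp_continuousOn h
  | succ m ih =>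
    obtain ⟨h0, f', hf', h'⟩ := h
    refine ⟨L.continuous.comp_continuousOn h0, fun x q => L.comp (f' x q), fun x q hq => ?_, ?_⟩
    · exact L.hasFDerivAt.comp_hasFDerivWithinAt q (hf' x q hq)
    · exact ih (ContinuousLinearMap.compL ℝ V W W' L) h'

theorem prodMk {f : X → V → W} {g : X → V → W'} (hf : ContDiffFamilyOn Q m f)
    (hg : ContDiffFamilyOn Q m g) : ContDiffFamilyOn Q m (fun x q => (f x q, g x q)) := by
  induction m generalizing W W' with
  | zero => exact ContinuousOn.prodMk hf hg
  | succ m ih =>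
    obtain ⟨hf0, f', hf', hf⟩ := hf
    obtain ⟨hg0, g', hg', hg⟩ := hg
    refine ⟨hf0.prodMk hg0, fun x q => (f' x q).prod (g' x q),
      fun x q hq => (hf' x q hq).prodMk (hg' x q hq), ?_⟩
    -- The derivative is the image of the pair `(f', g')` under a fixed continuous linear map, so
    -- the induction hypothesis for pairs applies.
    refine (clm_comp ((ContinuousLinearMap.compL ℝ V W (W × W') (.inl ℝ W W')).coprod
      (ContinuousLinearMap.compL ℝ V W' (W × W') (.inr ℝ W W'))) (ih hf hg)).congr fun x q _ => ?_
    ext v <;> simp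

theorem add {f g : X → V → W} (hf : ContDiffFamilyOn Q m f) (hg : ContDiffFamilyOn Q m g) :
    ContDiffFamilyOn Q m (fun x q => f x q + g x q) :=
  clm_comp (ContinuousLinearMap.fst ℝ W W + ContinuousLinearMap.snd ℝ W W) (hf.prodMk hg)

theorem neg {f : X → V → W} (hf : ContDiffFamilyOn Q m f) :
    ContDiffFamilyOn Q m (fun x q => -f x q) :=
  clm_comp (-ContinuousLinearMap.id ℝ W) hf

theorem sub {f g : X → V → W} (hf : ContDiffFamilyOn Q m f) (hg : ContDiffFamilyOn Q m g) :
    ContDiffFamilyOn Q m (fun x q => f x q - g x q) := by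
  simpa only [sub_eq_add_neg] using hf.add hg.neg

theorem bilin {f : X → V → W} {g : X → V → W'} (hf : ContDiffFamilyOn Q m f)
    (B : W →L[ℝ] W' →L[ℝ] W'') (hg : ContDiffFamilyOn Q m g) :
    ContDiffFamilyOn Q m (fun x q => B (f x q) (g x q)) := by
  have h0 {W W' W'' : Type u} [NormedAddCommGroup W] [NormedSpace ℝ W] [NormedAddCommGroup W']
      [NormedSpace ℝ W'] [NormedAddCommGroup W''] [NormedSpace ℝ W''] (B : W →L[ℝ] W' →L[ℝ] W'')
      {f : X → V → W} {g : X → V → W'} {m : ℕ} (hf : ContDiffFamilyOn Q m f)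
      (hg : ContDiffFamilyOn Q m g) :
      ContinuousOn (fun z : X × V => B (f z.1 z.2) (g z.1 z.2)) (univ ×ˢ Q) :=
    B.isBoundedBilinearMap.continuous.comp_continuousOn (hf.continuousOn.prodMk hg.continuousOn)
  induction m generalizing W W' W'' with
  | zero => exact h0 B hf hg
  | succ m ih =>
    have hf1 := hf.of_succ
    have hg1 := hg.of_succ
    have h00 := h0 B hf hg
    obtain ⟨_, f', hf', hf⟩ := hf
    obtain ⟨_, g', hg', hg⟩ := hg
    exact ⟨h00, _, fun x q hq => B.hasFDerivWithinAt_of_bilinear (hf' x q hq) (hg' x q hq),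
      (ih hf1 (B.precompR V) hg).add (ih hf (B.precompL V) hg1)⟩

theorem comp_param {f : X → V → W} (hf : ContDiffFamilyOn Q m f) {θ : X' → X}
    (hθ : Continuous θ) : ContDiffFamilyOn Q m (fun x => f (θ x)) := by
  have h0 : ContinuousOn (fun z : X' × V => f (θ z.1) z.2) (univ ×ˢ Q) :=
    hf.continuousOn.comp (f := fun z : X' × V => (θ z.1, z.2)) (by fun_prop)
      fun z hz => ⟨mem_univ _, hz.2⟩
  induction m generalizing W with
  | zero => exact h0
  | succ m ih =>
    obtain ⟨_, f', hf', hf⟩ := hf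
    refine ⟨h0, fun x => f' (θ x), fun x => hf' (θ x), ih hf ?_⟩
    exact hf.continuousOn.comp (f := fun z : X' × V => (θ z.1, z.2)) (by fun_prop)
      fun z hz => ⟨mem_univ _, hz.2⟩

theorem comp {f : X → V' → W} {g : X → V → V'} (hf : ContDiffFamilyOn Q' m f)
    (hg : ContDiffFamilyOn Q m g) (hgQ : ∀ x, MapsTo (g x) Q Q') :
    ContDiffFamilyOn Q m (fun x q => f x (g x q)) := by
  have h0 {W : Type u} [NormedAddCommGroup W] [NormedSpace ℝ W] {f : X → V' → W} {m : ℕ}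
      (hf : ContDiffFamilyOn Q' m f) :
      ContinuousOn (fun z : X × V => f z.1 (g z.1 z.2)) (univ ×ˢ Q) :=
    hf.continuousOn.comp (continuousOn_fst.prodMk hg.continuousOn)
      fun z hz => ⟨mem_univ _, hgQ z.1 hz.2⟩
  induction m generalizing W with
  | zero => exact h0 hf
  | succ m ih =>
    have hg1 := hg.of_succ
    have h00 := h0 hf
    obtain ⟨_, f', hf', hf⟩ := hf
    obtain ⟨_, g', hg', hg⟩ := hg
    refine ⟨h00, fun x q => (f' x (g x q)).comp (g' x q), fun x q hq => ?_, ?_⟩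
    · exact (hf' x _ (hgQ x hq)).comp q (hg' x q hq) (hgQ x)
    · exact bilin (ih hf hg1) (ContinuousLinearMap.compL ℝ V V' W) hg

theorem contDiffOn {f : X → V → W} (hQ : UniqueDiffOn ℝ Q) (hf : ContDiffFamilyOn Q m f) (x : X) :
    ContDiffOn ℝ m (f x) Q := by
  induction m generalizing W with
  | zero =>
    refine contDiffOn_zero.2 (hf.continuousOn.comp (f := fun q => (x, q)) (by fun_prop) ?_)
    exact fun q hq => ⟨mem_univ _, hq⟩
  | succ m ih =>
    obtain ⟨_, f', hf', hf⟩ := hf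
    rw [Nat.cast_add, Nat.cast_one, contDiffOn_succ_iff_hasFDerivWithinAt_of_uniqueDiffOn hQ]
    exact ⟨by simp, f' x, ih hf, hf' x⟩

theorem continuousOn_iteratedFDerivWithin {f : X → V → W} (hQ : UniqueDiffOn ℝ Q)
    (hf : ContDiffFamilyOn Q m f) :
    ContinuousOn (fun z : X × V => iteratedFDerivWithin ℝ m (f z.1) Q z.2) (univ ×ˢ Q) := by
  induction m generalizing W with
  | zero =>
    simp only [iteratedFDerivWithin_zero_eq_comp]
    exact (LinearIsometryEquiv.continuous _).comp_continuousOn hf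
  | succ m ih =>
    obtain ⟨_, f', hf', hf⟩ := hf
    -- Currying on the right makes the derivative of order `m + 1` of `f` the derivative of order
    -- `m` of `f'`.
    refine ((continuousMultilinearCurryRightEquiv' ℝ m V W).symm.continuous.comp_continuousOn
      (ih hf)).congr fun z hz => ?_
    rw [iteratedFDerivWithin_succ_eq_comp_right hQ hz.2]
    simp only [Function.comp_apply]
    rw [iteratedFDerivWithin_congr (fun q hq => (hf' z.1 q hq).fderivWithin (hQ q hq)) hz.2]

theorem _root_.ContDiffOn.contDiffFamilyOn {f : V → W} (hQ : UniqueDiffOn ℝ Q)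
    (hf : ContDiffOn ℝ m f Q) : ContDiffFamilyOn Q m (fun _ : X => f) := by
  have h0 : ContinuousOn (fun z : X × V => f z.2) (univ ×ˢ Q) :=
    hf.continuousOn.comp continuousOn_snd fun z hz => hz.2
  induction m generalizing W with
  | zero => exact h0
  | succ m ih =>
    rw [Nat.cast_add, Nat.cast_one, contDiffOn_succ_iff_hasFDerivWithinAt_of_uniqueDiffOn hQ] at hf
    obtain ⟨_, f', hf, hf'⟩ := hf
    refine ⟨h0, fun _ => f', fun _ => hf', ih hf ?_⟩
    exact hf.continuousOn.comp continuousOn_snd fun z hz => hz.2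

end ContDiffFamilyOn

section Scalar

variable {V W : Type} [NormedAddCommGroup V] [NormedSpace ℝ V] [NormedAddCommGroup W]
  [NormedSpace ℝ W] {Q : Set V} {m : ℕ}

theorem ContDiffFamilyOn.smul {f : X → V → ℝ} {g : X → V → W}
    (hf : ContDiffFamilyOn Q m f) (hg : ContDiffFamilyOn Q m g) :
    ContDiffFamilyOn Q m (fun x q => f x q • g x q) :=
  hf.bilin (ContinuousLinearMap.lsmul ℝ ℝ) hg

theorem ContDiffFamilyOn.mul {f g : X → V → ℝ}
    (hf : ContDiffFamilyOn Q m f) (hg : ContDiffFamilyOn Q m g) :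
    ContDiffFamilyOn Q m (fun x q => f x q * g x q) :=
  hf.bilin (ContinuousLinearMap.mul ℝ ℝ) hg

end Scalar

/-! ### Integrals depending on parameters, over a compact space. -/

section Integral

open MeasureTheory

variable {I : Type*} [TopologicalSpace I] [CompactSpace I] [MeasurableSpace I] [BorelSpace I]
  (μ : Measure I) [IsFiniteMeasure μ]

-- Tube lemma: since `I` is compact, joint continuity at all points `((x, σ), q)` gives an estimate
-- uniform in `σ`. Passing to the subtype `Q` turns relative continuity into plain continuity.
omit [NormedSpace ℝ V] [NormedSpace ℝ W] [MeasurableSpace I] [BorelSpace I] in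
theorem ContDiffFamilyOn.tendstoUniformly_slice {f : X × I → V → W} {Q : Set V}
    (hf : ContinuousOn (fun z : (X × I) × V => f z.1 z.2) (univ ×ˢ Q)) (x : X) {q : V}
    (hq : q ∈ Q) {ε : ℝ} (hε : 0 < ε) :
    ∀ᶠ z in 𝓝 x ×ˢ 𝓝[Q] q, ∀ σ, dist (f (z.1, σ) z.2) (f (x, σ) q) < ε := by
  have hc : Continuous fun p : I × (X × Q) => f (p.2.1, p.1) p.2.2 :=
    hf.comp_continuous (f := fun p : I × (X × Q) => ((p.2.1, p.1), (p.2.2 : V)))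
      (by fun_prop) fun p => ⟨mem_univ _, p.2.2.2⟩
  have hd : Continuous fun p : I × (X × Q) => dist (f (p.2.1, p.1) p.2.2) (f (x, p.1) q) := by
    refine hc.dist ?_
    exact hc.comp (g := fun p : I × (X × Q) => f (p.2.1, p.1) p.2.2)
      (f := fun p : I × (X × Q) => (p.1, (x, (⟨q, hq⟩ : Q)))) (by fun_prop)
  have := isCompact_univ.eventually_forall_of_forall_eventually (X := X × Q) (Y := I)
    (x₀ := (x, ⟨q, hq⟩)) (K := univ)
    (P := fun z σ => dist (f (z.1, σ) z.2) (f (x, σ) q) < ε) fun σ _ => by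
      have := (hd.comp (g := fun p : I × (X × Q) => dist (f (p.2.1, p.1) p.2.2) (f (x, p.1) q))
        (continuous_swap)).continuousAt (x := ((x, ⟨q, hq⟩), σ))
      exact this.eventually (gt_mem_nhds (by simpa using hε))
  rw [nhds_prod_eq, nhds_subtype_eq_comap_nhdsWithin, ← Filter.comap_id (f := 𝓝 x),
    Filter.prod_comap_comap_eq, eventually_comap] at this
  have h2 : ∀ᶠ z : X × V in 𝓝 x ×ˢ 𝓝[Q] q, z.2 ∈ Q :=
    tendsto_snd.eventually self_mem_nhdsWithin
  filter_upwards [this, h2] with z hz hzQ σ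
  exact hz (z.1, ⟨z.2, hzQ⟩) rfl σ (mem_univ _)

/-- Differentiation under the integral sign. Convexity of `Q` allows the mean value inequality on a
small ball intersected with `Q`, which bounds the remainder uniformly in `σ`. -/
theorem ContDiffFamilyOn.integral [CompleteSpace W] {f : X × I → V → W} {Q : Set V} {m : ℕ}
    (hQ : Convex ℝ Q) (hf : ContDiffFamilyOn Q m f) :
    ContDiffFamilyOn Q m (fun x q => ∫ σ, f (x, σ) q ∂μ) := by
  have hint {W : Type u} [NormedAddCommGroup W] [NormedSpace ℝ W] {f : X × I → V → W}
      (hf : ContinuousOn (fun z : (X × I) × V => f z.1 z.2) (univ ×ˢ Q)) (x : X) {q : V}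
      (hq : q ∈ Q) : Integrable (fun σ => f (x, σ) q) μ := by
    have : Continuous fun σ => f (x, σ) q :=
      hf.comp_continuous (f := fun σ => ((x, σ), q)) (by fun_prop) fun p => ⟨mem_univ _, hq⟩
    exact this.integrable_of_hasCompactSupport (HasCompactSupport.of_compactSpace _)
  have h0 {W : Type u} [NormedAddCommGroup W] [NormedSpace ℝ W] {f : X × I → V → W}
      (hf : ContinuousOn (fun z : (X × I) × V => f z.1 z.2) (univ ×ˢ Q)) :
      ContinuousOn (fun z : X × V => ∫ σ, f (z.1, σ) z.2 ∂μ) (univ ×ˢ Q) := by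
    rintro ⟨x, q⟩ hz
    have hq : q ∈ Q := hz.2
    rw [ContinuousWithinAt, nhdsWithin_prod_eq, nhdsWithin_univ, Metric.tendsto_nhds]
    intro ε hε
    -- The summand 1 covers the case of measure zero and keeps the final estimate strict.
    have hε' : 0 < ε / (μ.real univ + 1) := by positivity
    have h2 : ∀ᶠ z : X × V in 𝓝 x ×ˢ 𝓝[Q] q, z.2 ∈ Q :=
      tendsto_snd.eventually self_mem_nhdsWithin
    filter_upwards [tendstoUniformly_slice hf x hq hε', h2] with z hz hzQ
    rw [dist_eq_norm, ← integral_sub (hint hf _ hzQ) (hint hf _ hq)]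
    refine (norm_integral_le_of_norm_le_const (C := ε / (μ.real univ + 1))
      (Eventually.of_forall fun σ => ?_)).trans_lt ?_
    · rw [← dist_eq_norm]; exact (hz σ).le
    · rw [div_mul_eq_mul_div, div_lt_iff₀ (by positivity)]
      gcongr
      linarith
  induction m generalizing W with
  | zero => exact h0 hf
  | succ m ih =>
    obtain ⟨hf0, f', hf', hf⟩ := hf
    refine ⟨h0 hf0, fun x q => ∫ σ, f' (x, σ) q ∂μ, fun x q hq => ?_, ih hf⟩
    rw [hasFDerivWithinAt_iff_isLittleO, Asymptotics.isLittleO_iff]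
    intro ε hε
    have hε' : 0 < ε / (μ.real univ + 1) := by positivity
    have h1 := tendstoUniformly_slice hf.continuousOn x hq hε'
    have h2 : ∀ᶠ r in 𝓝[Q] q, ∀ σ, dist (f' (x, σ) r) (f' (x, σ) q) < ε / (μ.real univ + 1) :=
      Filter.Tendsto.eventually (f := fun r => (x, r)) (tendsto_const_nhds.prodMk tendsto_id) h1
    obtain ⟨δ, hδ, hδ'⟩ := Metric.mem_nhdsWithin_iff.1 h2
    have h3 : Metric.ball q δ ∩ Q ∈ 𝓝[Q] q := inter_comm Q _ ▸ inter_mem_nhdsWithin _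
      (Metric.ball_mem_nhds _ hδ)
    filter_upwards [h3] with r hr
    have hconv : Convex ℝ (Metric.ball q δ ∩ Q) := (convex_ball q δ).inter hQ
    have hest (σ : I) : ‖f (x, σ) r - f (x, σ) q - f' (x, σ) q (r - q)‖ ≤
        ε / (μ.real univ + 1) * ‖r - q‖ := by
      refine hconv.norm_image_sub_le_of_norm_hasFDerivWithin_le' (f' := f' (x, σ))
        (fun y hy => (hf' (x, σ) y hy.2).mono inter_subset_right) (fun y hy => ?_)
        ⟨Metric.mem_ball_self hδ, hq⟩ hr
      rw [← dist_eq_norm]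
      exact (hδ' hy σ).le
    have hi1 := hint hf0 x hr.2
    have hi2 := hint hf0 x hq
    have hi3 := hint hf.continuousOn x hq
    rw [ContinuousLinearMap.integral_apply hi3, ← integral_sub hi1 hi2,
      ← integral_sub (f := fun σ => f (x, σ) r - f (x, σ) q) (hi1.sub hi2)
        (hi3.apply_continuousLinearMap _)]
    refine (norm_integral_le_of_norm_le_const (Eventually.of_forall hest)).trans ?_
    rw [mul_right_comm]
    gcongr
    rw [div_mul_eq_mul_div, div_le_iff₀ (by positivity)]
    gcongr
    linarith

end Integral

end Families

/-! ### Continuity and directional derivatives in the spaces of smooth functions. -/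

noncomputable section

theorem unitInterval.integral_eq_intervalIntegral (g : ℝ → ℝ) :
    ∫ σ : unitInterval, g σ = ∫ σ in (0 : ℝ)..1, g σ := by
  rw [intervalIntegral.integral_of_le zero_le_one, ← MeasureTheory.integral_Icc_eq_integral_Ioc]
  exact MeasureTheory.integral_subtype_comap measurableSet_Icc g

namespace SmoothSpace

variable {V : Type} [NormedAddCommGroup V] [NormedSpace ℝ V] {Q : Set V} {p : V}

theorem ext {f g : SmoothSpace Q p} (h : ∀ q ∈ Q, f q = g q) : f = g := by
  refine Subtype.ext (funext fun q => ?_)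
  by_cases hq : q ∈ Q
  · exact h q hq
  · exact (f.2.2.1 q hq).trans (g.2.2.1 q hq).symm

theorem periodic (f : SmoothSpace Q p) (q : V) : f (q + p) = f q := f.2.2.2 q

theorem add_apply (f g : SmoothSpace Q p) (q : V) : (f + g) q = f q + g q := rfl

theorem neg_apply (f : SmoothSpace Q p) (q : V) : (-f) q = -f q := rfl

theorem smul_apply (c : ℝ) (f : SmoothSpace Q p) (q : V) : (c • f) q = c * f q := rfl

theorem continuousOn (f : SmoothSpace Q p) : ContinuousOn f Q := f.contDiffOn.continuousOn

theorem differentiableOn (f : SmoothSpace Q p) : DifferentiableOn ℝ f Q :=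
  f.contDiffOn.differentiableOn (by simp)

theorem hasFDerivWithinAt (f : SmoothSpace Q p) {q : V} (hq : q ∈ Q) :
    HasFDerivWithinAt f (fderivWithin ℝ f Q q) Q q :=
  (f.differentiableOn q hq).hasFDerivWithinAt

section

variable [hQ : Fact (UniqueDiffOn ℝ Q)]

theorem norm_iteratedFDerivWithin_le_seminorm (f : SmoothSpace Q p) (m : ℕ) {K : Set V}
    (hK : IsCompact K) (hKQ : K ⊆ Q) {q : V} (hq : q ∈ K) :
    ‖iteratedFDerivWithin ℝ m f Q q‖ ≤ seminormFamily Q p (m, ⟨K, hK, hKQ⟩) f :=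
  le_ciSup (f.bddAbove m hK hKQ) (⟨q, hq⟩ : K)

theorem iteratedFDerivWithin_sub (f g : SmoothSpace Q p) (m : ℕ) {q : V} (hq : q ∈ Q) :
    iteratedFDerivWithin ℝ m (f - g : SmoothSpace Q p) Q q =
      iteratedFDerivWithin ℝ m f Q q - iteratedFDerivWithin ℝ m g Q q := by
  have hle : ((m : ℕ∞) : WithTop ℕ∞) ≤ ∞ := by exact_mod_cast (le_top : (m : ℕ∞) ≤ ⊤)
  exact iteratedFDerivWithin_sub_apply ((f.contDiffOn q hq).of_le hle)
    ((g.contDiffOn q hq).of_le hle) hQ.out hq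

/-- A map into a space of smooth functions is continuous if all derivatives are jointly
continuous. -/
theorem continuous_of_contDiffFamilyOn {X : Type*} [TopologicalSpace X] {G : X → SmoothSpace Q p}
    (hG : ∀ m, ContDiffFamilyOn Q m fun x => (G x : V → ℝ)) : Continuous G := by
  refine continuous_iff_continuousAt.2 fun x₀ => ?_
  refine (withSeminorms.tendsto_nhds _ _).2 fun ⟨m, K, hK, hKQ⟩ ε hε => ?_
  have hc := (hG m).continuousOn_iteratedFDerivWithin hQ.out
  have hd : Continuous fun z : K × X => ‖iteratedFDerivWithin ℝ m (G z.2) Q z.1 -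
      iteratedFDerivWithin ℝ m (G x₀) Q z.1‖ := by
    refine Continuous.norm (Continuous.sub ?_ ?_)
    · exact hc.comp_continuous (f := fun z : K × X => (z.2, (z.1 : V))) (by fun_prop)
        fun z => ⟨mem_univ _, hKQ z.1.2⟩
    · exact hc.comp_continuous (f := fun z : K × X => (x₀, (z.1 : V))) (by fun_prop)
        fun z => ⟨mem_univ _, hKQ z.1.2⟩
  have := isCompact_iff_compactSpace.1 hK
  have := isCompact_univ.eventually_forall_of_forall_eventually (K := (univ : Set K)) (x₀ := x₀)
    (P := fun x q => ‖iteratedFDerivWithin ℝ m (G x) Q q -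
      iteratedFDerivWithin ℝ m (G x₀) Q q‖ < ε / 2) fun q _ =>
        (hd.comp continuous_swap).continuousAt.eventually
          (gt_mem_nhds (by simpa using half_pos hε))
  filter_upwards [this] with x hx
  refine lt_of_le_of_lt (Real.iSup_le (fun q => ?_) (half_pos hε).le) (half_lt_self hε)
  rw [iteratedFDerivWithin_sub _ _ _ (hKQ q.2)]
  exact (hx q (mem_univ _)).le

variable [ProperSpace V] [hQc : Fact (IsClosed Q)]

/-- Near `q` all points of `Q` lie in `closedBall q 1 ∩ Q`, which is compact because `V` is proper
and `Q` is closed; the seminorm of this one set controls the variation in `f`. -/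
theorem continuousOn_iteratedFDerivWithin_eval (m : ℕ) :
    ContinuousOn (fun z : SmoothSpace Q p × V => iteratedFDerivWithin ℝ m z.1 Q z.2)
      (univ ×ˢ Q) := by
  rintro ⟨f, q⟩ hz
  have hq : q ∈ Q := hz.2
  rw [ContinuousWithinAt, nhdsWithin_prod_eq, nhdsWithin_univ, Metric.tendsto_nhds]
  intro ε hε
  have hK : IsCompact (Metric.closedBall q 1 ∩ Q) :=
    (isCompact_closedBall q 1).inter_right hQc.out
  have h1 : ∀ᶠ g in 𝓝 f, seminormFamily Q p (m, ⟨_, hK, inter_subset_right⟩) (g - f) < ε / 2 :=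
    (withSeminorms.tendsto_nhds id f).1 tendsto_id _ _ (half_pos hε)
  have hle : ((m : ℕ∞) : WithTop ℕ∞) ≤ ∞ := by exact_mod_cast (le_top : (m : ℕ∞) ≤ ⊤)
  have h2 : ∀ᶠ r in 𝓝[Q] q, dist (iteratedFDerivWithin ℝ m f Q r)
      (iteratedFDerivWithin ℝ m f Q q) < ε / 2 :=
    Metric.tendsto_nhds.1 (f.contDiffOn.continuousOn_iteratedFDerivWithin hle hQ.out q hq) _
      (half_pos hε)
  have h3 : ∀ᶠ r in 𝓝[Q] q, r ∈ Metric.closedBall q 1 ∩ Q := by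
    filter_upwards [self_mem_nhdsWithin, mem_nhdsWithin_of_mem_nhds
      (Metric.closedBall_mem_nhds q one_pos)] with r h h' using ⟨h', h⟩
  filter_upwards [h1.prod_mk (h2.and h3)] with z ⟨hz1, hz2, hz3⟩
  refine (dist_triangle _ (iteratedFDerivWithin ℝ m f Q z.2) _).trans_lt ?_
  rw [← add_halves ε]
  refine add_lt_add (lt_of_le_of_lt ?_ hz1) hz2
  rw [dist_eq_norm, ← iteratedFDerivWithin_sub _ _ _ hz3.2]
  exact norm_iteratedFDerivWithin_le_seminorm _ _ hK inter_subset_right hz3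

theorem contDiffFamilyOn_iteratedFDerivWithin (m k : ℕ) :
    ContDiffFamilyOn Q m fun (f : SmoothSpace Q p) q => iteratedFDerivWithin ℝ k f Q q := by
  induction m generalizing k with
  | zero => exact continuousOn_iteratedFDerivWithin_eval k
  | succ m ih =>
    refine ⟨continuousOn_iteratedFDerivWithin_eval k, _, fun f q hq => ?_,
      (ih (k + 1)).clm_comp
        (continuousMultilinearCurryLeftEquiv ℝ (fun _ : Fin (k + 1) => V) ℝ
          ).toContinuousLinearEquiv.toContinuousLinearMap⟩
    have hlt : ((k : ℕ∞) : WithTop ℕ∞) < ∞ := by exact_mod_cast WithTop.coe_lt_top k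
    have hd := (f.contDiffOn.differentiableOn_iteratedFDerivWithin hlt hQ.out q hq
      ).hasFDerivWithinAt
    rw [iteratedFDerivWithin_succ_eq_comp_left]
    simpa using hd

/-- This is the universal family: with `ContDiffFamilyOn.comp_param` it turns every continuous map
into the function space into a family of class `C^m`. It is the converse of
`continuous_of_contDiffFamilyOn`. -/
theorem contDiffFamilyOn_eval (m : ℕ) :
    ContDiffFamilyOn Q m fun (f : SmoothSpace Q p) => (f : V → ℝ) := by
  refine ((contDiffFamilyOn_iteratedFDerivWithin m 0).clm_comp
    (continuousMultilinearCurryFin0 ℝ V ℝ).toContinuousLinearEquiv.toContinuousLinearMap).congr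
    fun f q _ => ?_
  simp

end

section

variable [hp : Fact (∀ q, q + p ∈ Q ↔ q ∈ Q)]

/-- The element of the space `C^∞(Q)` given by a function which is smooth and periodic on `Q`. -/
def ofContDiffOn (g : V → ℝ) (hg : ContDiffOn ℝ ∞ g Q) (hper : ∀ q ∈ Q, g (q + p) = g q) :
    SmoothSpace Q p :=
  ⟨Q.indicator g, hg.congr fun q hq => indicator_of_mem hq g,
    fun q hq => indicator_of_notMem hq g, fun q => by
      by_cases hq : q ∈ Q
      · rw [indicator_of_mem hq, indicator_of_mem ((hp.out q).2 hq), hper q hq]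
      · rw [indicator_of_notMem hq, indicator_of_notMem (mt (hp.out q).1 hq)]⟩

theorem ofContDiffOn_apply {g : V → ℝ} {hg : ContDiffOn ℝ ∞ g Q}
    {hper : ∀ q ∈ Q, g (q + p) = g q} {q : V} (hq : q ∈ Q) :
    ofContDiffOn g hg hper q = g q := indicator_of_mem hq g

variable [hQ : Fact (UniqueDiffOn ℝ Q)]

/-- A family of periodic functions with jointly continuous derivatives of all orders is a
continuous map into the space of smooth functions. -/
theorem exists_continuous_of_contDiffFamilyOn {X : Type*} [TopologicalSpace X] {g : X → V → ℝ}
    (hg : ∀ m, ContDiffFamilyOn Q m g) (hper : ∀ x, ∀ q ∈ Q, g x (q + p) = g x q) :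
    ∃ G : X → SmoothSpace Q p, Continuous G ∧ ∀ x, ∀ q ∈ Q, G x q = g x q := by
  have h1 x : ContDiffOn ℝ ∞ (g x) Q := contDiffOn_infty.2 fun m => (hg m).contDiffOn hQ.out x
  refine ⟨fun x => ofContDiffOn (g x) (h1 x) (hper x),
    continuous_of_contDiffFamilyOn fun m => (hg m).congr fun x q hq => ?_,
    fun x q hq => ofContDiffOn_apply hq⟩
  exact ofContDiffOn_apply hq

omit hQ in
open scoped Pointwise in
theorem fderivWithin_periodic (f : SmoothSpace Q p) (q : V) :
    fderivWithin ℝ f Q (q + p) = fderivWithin ℝ f Q q := by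
  have h : p +ᵥ Q = Q := by
    ext r
    rw [mem_vadd_set_iff_neg_vadd_mem, ← hp.out, vadd_eq_add, add_comm, ← add_assoc,
      add_neg_cancel, zero_add]
  have := fderivWithin_comp_add_right (𝕜 := ℝ) (f := f) (s := Q) (x := q) p
  rw [h] at this
  rw [← this]
  congr 1
  exact funext f.periodic

/-- The derivative in the direction `v`. -/
def dirDeriv (v : V) (f : SmoothSpace Q p) : SmoothSpace Q p :=
  ofContDiffOn (fun q => fderivWithin ℝ f Q q v)
    (((ContinuousLinearMap.apply ℝ ℝ v).contDiff.comp_contDiffOn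
      (f.contDiffOn.fderivWithin hQ.out (by simp))))
    fun q _ => by rw [f.fderivWithin_periodic]

theorem dirDeriv_apply {v : V} {f : SmoothSpace Q p} {q : V} (hq : q ∈ Q) :
    dirDeriv v f q = fderivWithin ℝ f Q q v := ofContDiffOn_apply hq

variable [ProperSpace V] [hQc : Fact (IsClosed Q)]

theorem continuous_dirDeriv (v : V) : Continuous (dirDeriv v : SmoothSpace Q p → _) := by
  refine continuous_of_contDiffFamilyOn fun m => ?_
  obtain ⟨_, f', hf', h'⟩ := contDiffFamilyOn_eval (Q := Q) (p := p) (m + 1)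
  refine (h'.clm_comp (ContinuousLinearMap.apply ℝ ℝ v)).congr fun f q hq => ?_
  rw [dirDeriv_apply hq, (hf' f q hq).fderivWithin (hQ.out q hq)]
  rfl

/-- Differentiation in the direction `v`, as a continuous linear map. -/
def dirDerivCLM (v : V) : SmoothSpace Q p →L[ℝ] SmoothSpace Q p where
  toFun := dirDeriv v
  map_add' f g := ext fun q hq => by
    rw [add_apply, dirDeriv_apply hq, dirDeriv_apply hq, dirDeriv_apply hq, coe_add,
      fderivWithin_add (hQ.out q hq) (f.differentiableOn q hq) (g.differentiableOn q hq)]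
    rfl
  map_smul' c f := ext fun q hq => by
    rw [RingHom.id_apply, smul_apply, dirDeriv_apply hq, dirDeriv_apply hq, coe_smul,
      fderivWithin_const_smul (hQ.out q hq) (f.differentiableOn q hq)]
    rfl
  cont := continuous_dirDeriv v

theorem dirDerivCLM_apply {v : V} {f : SmoothSpace Q p} {q : V} (hq : q ∈ Q) :
    dirDerivCLM v f q = fderivWithin ℝ f Q q v := dirDeriv_apply hq

/-- Hadamard's formula along a line contained in the domain. -/
theorem sub_eq_mul_integral_dirDeriv (f : SmoothSpace Q p) {q e : V}
    (hq : ∀ s : ℝ, q + s • e ∈ Q) (c : ℝ) :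
    f (q + c • e) - f q = c * ∫ σ : unitInterval, dirDerivCLM e f (q + (σ * c) • e) := by
  have hd (s : ℝ) : HasDerivAt (fun s : ℝ => f (q + (s * c) • e))
      (c * dirDerivCLM e f (q + (s * c) • e)) s := by
    have h1 : HasDerivAt (fun s : ℝ => q + (s * c) • e) (c • e) s := by
      simpa using (((hasDerivAt_id s).mul_const c).smul_const e).const_add q
    have h2 := (f.hasFDerivWithinAt (hq (s * c))).comp_hasDerivWithinAt s
      (h1.hasDerivWithinAt (s := univ)) fun s _ => hq (s * c)
    rw [hasDerivWithinAt_univ] at h2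
    convert! h2 using 1
    rw [dirDerivCLM_apply (hq _), map_smul, smul_eq_mul]
  have hcont : Continuous fun s : ℝ => c * dirDerivCLM e f (q + (s * c) • e) :=
    continuous_const.mul ((dirDerivCLM e f).continuousOn.comp_continuous (by fun_prop)
      fun s => hq (s * c))
  have := intervalIntegral.integral_eq_sub_of_hasDerivAt (a := 0) (b := 1) (fun s _ => hd s)
    (hcont.intervalIntegrable _ _)
  rw [intervalIntegral.integral_const_mul] at this
  rw [unitInterval.integral_eq_intervalIntegral fun s => dirDerivCLM e f (q + (s * c) • e), this]
  simp

end

end SmoothSpace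

end

noncomputable section

/-! Differential calculus in topological vector spaces, based on continuous extensions of
difference quotients (Bertram, Glöckner and Neeb). -/

section DifferenceQuotients

/-- The triples `(x, h, t)` for which the difference quotient `(f (x + t h) - f x) / t` of a
function `f` on `U` has a meaning, possibly after an extension to `t = 0`. -/
def quotDomain {A : Type*} [AddCommGroup A] [Module ℝ A] (U : Set A) : Set (A × A × ℝ) :=
  {z | z.1 ∈ U ∧ z.1 + z.2.2 • z.2.1 ∈ U}

/-- The function `f` is of class `C^n` on `U`, in the sense that it has continuous iterated
difference quotients, extended to parameters `t = 0`, up to order `n`. -/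
def QuotDiffOn {B : Type*} [AddCommGroup B] [Module ℝ B] [TopologicalSpace B] :
    (n : ℕ) → {A : Type} → [AddCommGroup A] → [Module ℝ A] → [TopologicalSpace A] →
      (f : A → B) → (U : Set A) → Prop
  | 0, _, _, _, _, f, U => ContinuousOn f U
  | n + 1, A, _, _, _, f, U => ContinuousOn f U ∧ ∃ g : A × A × ℝ → B,
      QuotDiffOn n g (quotDomain U) ∧
        ∀ x h, ∀ t : ℝ, x ∈ U → x + t • h ∈ U → f (x + t • h) = f x + t • g (x, h, t)

variable {A A' : Type} {B B' B'' : Type}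
  [AddCommGroup A] [Module ℝ A] [TopologicalSpace A]
  [AddCommGroup A'] [Module ℝ A'] [TopologicalSpace A']
  [AddCommGroup B] [Module ℝ B] [TopologicalSpace B]
  [AddCommGroup B'] [Module ℝ B'] [TopologicalSpace B']
  [AddCommGroup B''] [Module ℝ B''] [TopologicalSpace B'']
  {n : ℕ} {U : Set A} {U' : Set A'} {f : A → B}

theorem isOpen_quotDomain [IsTopologicalAddGroup A] [ContinuousSMul ℝ A] (hU : IsOpen U) :
    IsOpen (quotDomain U) := by
  refine (hU.preimage continuous_fst).inter (hU.preimage ?_)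
  fun_prop

namespace QuotDiffOn

theorem continuousOn (h : QuotDiffOn n f U) : ContinuousOn f U := by
  cases n with
  | zero => exact h
  | succ n => exact h.1

theorem congr {f' : A → B} (h : QuotDiffOn n f U) (hf : EqOn f' f U) : QuotDiffOn n f' U := by
  have h0 := h.continuousOn.congr hf
  cases n with
  | zero => exact h0
  | succ n =>
    obtain ⟨_, g, hg, hfg⟩ := h
    refine ⟨h0, g, hg, fun x h t hx hxt => ?_⟩
    rw [hf hx, hf hxt, hfg x h t hx hxt]

theorem mono {U₁ : Set A} (h : QuotDiffOn n f U) (hU : U₁ ⊆ U) : QuotDiffOn n f U₁ := by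
  induction n generalizing A with
  | zero => exact ContinuousOn.mono h hU
  | succ n ih =>
    obtain ⟨h0, g, hg, hfg⟩ := h
    exact ⟨h0.mono hU, g, ih hg fun z hz => ⟨hU hz.1, hU hz.2⟩,
      fun x h t hx hxt => hfg x h t (hU hx) (hU hxt)⟩

theorem of_succ (h : QuotDiffOn (n + 1) f U) : QuotDiffOn n f U := by
  induction n generalizing A with
  | zero => exact h.1
  | succ n ih =>
    obtain ⟨h0, g, hg, hfg⟩ := h
    exact ⟨h0, g, ih hg, hfg⟩

theorem clm (L : A →L[ℝ] B) : QuotDiffOn n L U := by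
  induction n generalizing A with
  | zero => exact L.continuous.continuousOn
  | succ n ih =>
    refine ⟨L.continuous.continuousOn, fun z => L z.2.1, ?_, fun x h t _ _ => ?_⟩
    · exact ih (L.comp ((ContinuousLinearMap.fst ℝ A ℝ).comp (ContinuousLinearMap.snd ℝ A (A × ℝ))))
    · rw [map_add, map_smul]

theorem const (c : B) : QuotDiffOn n (fun _ : A => c) U := by
  induction n generalizing A c with
  | zero => exact continuousOn_const
  | succ n ih => exact ⟨continuousOn_const, fun _ => 0, ih 0, fun x h t _ _ => by simp⟩

theorem prodMk {f' : A → B'} (hf : QuotDiffOn n f U) (hf' : QuotDiffOn n f' U) :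
    QuotDiffOn n (fun x => (f x, f' x)) U := by
  induction n generalizing A with
  | zero => exact ContinuousOn.prodMk hf hf'
  | succ n ih =>
    obtain ⟨h0, g, hg, hfg⟩ := hf
    obtain ⟨h0', g', hg', hfg'⟩ := hf'
    refine ⟨h0.prodMk h0', _, ih hg hg', fun x h t hx hxt => ?_⟩
    exact Prod.ext (hfg x h t hx hxt) (hfg' x h t hx hxt)

/-- Chain rule for quotients: the quotient of the composite is `g (f' x, g' (x, h, t), t)`, itself a
composite of maps of class `C^n`. -/
theorem comp {f' : A' → A} (hf : QuotDiffOn n f U) (hf' : QuotDiffOn n f' U')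
    (hU : MapsTo f' U' U) : QuotDiffOn n (fun x => f (f' x)) U' := by
  induction n generalizing A A' B with
  | zero => exact ContinuousOn.comp hf hf' hU
  | succ n ih =>
    have hf1 := hf'.of_succ
    obtain ⟨h0, g, hg, hfg⟩ := hf
    obtain ⟨h0', g', hg', hfg'⟩ := hf'
    refine ⟨h0.comp h0' hU, fun z => g (f' z.1, g' z, z.2.2), ih hg (prodMk ?_ (prodMk hg' ?_)) ?_,
      fun x h t hx hxt => ?_⟩
    · exact ih hf1 (clm (ContinuousLinearMap.fst ℝ A' (A' × ℝ))) fun z hz => hz.1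
    · exact clm ((ContinuousLinearMap.snd ℝ A' ℝ).comp (ContinuousLinearMap.snd ℝ A' (A' × ℝ)))
    · rintro ⟨x, h, t⟩ ⟨hx, hxt⟩
      refine ⟨hU hx, ?_⟩
      have := hfg' x h t hx hxt
      simp only at this hxt ⊢
      rw [← this]
      exact hU hxt
    · have h1 := hfg' x h t hx hxt
      have h2 := hfg _ _ _ (hU hx) (by rw [← h1]; exact hU hxt)
      rw [← h1] at h2
      exact h2

theorem clm_comp (L : B →L[ℝ] B') (hf : QuotDiffOn n f U) : QuotDiffOn n (fun x => L (f x)) U :=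
  (clm (U := univ) L).comp hf (mapsTo_univ _ _)

theorem fst {f : A → B × B'} (hf : QuotDiffOn n f U) : QuotDiffOn n (fun x => (f x).1) U :=
  hf.clm_comp (ContinuousLinearMap.fst ℝ B B')

theorem snd {f : A → B × B'} (hf : QuotDiffOn n f U) : QuotDiffOn n (fun x => (f x).2) U :=
  hf.clm_comp (ContinuousLinearMap.snd ℝ B B')

theorem id : QuotDiffOn n (fun x : A => x) U := clm (ContinuousLinearMap.id ℝ A)

theorem add [IsTopologicalAddGroup B] {f' : A → B} (hf : QuotDiffOn n f U)
    (hf' : QuotDiffOn n f' U) : QuotDiffOn n (fun x => f x + f' x) U :=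
  clm_comp (ContinuousLinearMap.fst ℝ B B + ContinuousLinearMap.snd ℝ B B) (hf.prodMk hf')

theorem neg [IsTopologicalAddGroup B] (hf : QuotDiffOn n f U) :
    QuotDiffOn n (fun x => -f x) U :=
  clm_comp (-ContinuousLinearMap.id ℝ B) hf

theorem sub [IsTopologicalAddGroup B] {f' : A → B} (hf : QuotDiffOn n f U)
    (hf' : QuotDiffOn n f' U) : QuotDiffOn n (fun x => f x - f' x) U :=
  clm_comp (ContinuousLinearMap.fst ℝ B B - ContinuousLinearMap.snd ℝ B B) (hf.prodMk hf')

/-- The quotient of `(x, h, t) ↦ x + t h` in direction `(x', h', t')` with parameter `s` is `(x' + t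
h') + t' (h + s h')`, built from maps of the same form. The direct induction is needed because the
product rule `bilin` already uses this result. -/
theorem add_smul [IsTopologicalAddGroup A] [ContinuousSMul ℝ A] {U : Set (A × A × ℝ)} :
    QuotDiffOn n (fun z : A × A × ℝ => z.1 + z.2.2 • z.2.1) U := by
  refine mono ?_ (subset_univ U)
  induction n with
  | zero => exact Continuous.continuousOn (by fun_prop)
  | succ n ih =>
    refine ⟨Continuous.continuousOn (by fun_prop),
      fun z => (z.2.1.1 + z.1.2.2 • z.2.1.2.1) +
        z.2.1.2.2 • (z.1.2.1 + z.2.2 • z.2.1.2.1), ?_, fun x h t _ _ => ?_⟩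
    · refine QuotDiffOn.comp (f' := fun z : (A × A × ℝ) × (A × A × ℝ) × ℝ =>
        (z.2.1.1 + z.1.2.2 • z.2.1.2.1, z.1.2.1 + z.2.2 • z.2.1.2.1, z.2.1.2.2)) ih
        (prodMk ?_ (prodMk ?_ (fst id.snd).snd.snd)) (mapsTo_univ _ _)
      · exact QuotDiffOn.comp (f' := fun z : (A × A × ℝ) × (A × A × ℝ) × ℝ =>
          (z.2.1.1, z.2.1.2.1, z.1.2.2)) ih
          (prodMk (fst id.snd).fst (prodMk (fst id.snd).snd.fst (fst id).snd.snd)) (mapsTo_univ _ _)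
      · exact QuotDiffOn.comp (f' := fun z : (A × A × ℝ) × (A × A × ℝ) × ℝ =>
          (z.1.2.1, z.2.1.2.1, z.2.2)) ih
          (prodMk (fst id).snd.fst (prodMk (fst id.snd).snd.fst id.snd.snd)) (mapsTo_univ _ _)
    · simp only [Prod.fst_add, Prod.snd_add, Prod.smul_fst, Prod.smul_snd, smul_eq_mul]
      module

theorem comp_add_smul [IsTopologicalAddGroup A] [ContinuousSMul ℝ A] (hf : QuotDiffOn n f U) :
    QuotDiffOn n (fun z : A × A × ℝ => f (z.1 + z.2.2 • z.2.1)) (quotDomain U) :=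
  hf.comp add_smul fun _ hz => hz.2

/-- Product rule without remainder: one factor is evaluated at the shifted point `x + t h`, the
other at `x`. Joint continuity of `β` is assumed separately, which avoids any topology on spaces of
linear maps. -/
theorem bilin [IsTopologicalAddGroup A] [ContinuousSMul ℝ A] [IsTopologicalAddGroup B'']
    (β : B →ₗ[ℝ] B' →ₗ[ℝ] B'') (hβ : Continuous fun z : B × B' => β z.1 z.2)
    {f' : A → B'} (hf : QuotDiffOn n f U) (hf' : QuotDiffOn n f' U) :
    QuotDiffOn n (fun x => β (f x) (f' x)) U := by
  induction n generalizing A with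
  | zero => exact hβ.comp_continuousOn (hf.continuousOn.prodMk hf'.continuousOn)
  | succ n ih =>
    have hf1 := hf.of_succ
    have hf1' := hf'.of_succ
    obtain ⟨h0, g, hg, hfg⟩ := hf
    obtain ⟨h0', g', hg', hfg'⟩ := hf'
    refine ⟨hβ.comp_continuousOn (h0.prodMk h0'),
      fun z => β (g z) (f' (z.1 + z.2.2 • z.2.1)) + β (f z.1) (g' z), ?_, fun x h t hx hxt => ?_⟩
    · exact (ih hg hf1'.comp_add_smul).add (ih (hf1.comp id.fst fun z hz => hz.1) hg')
    · have h1 := hfg x h t hx hxt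
      have h1' := hfg' x h t hx hxt
      simp only
      rw [h1, h1']
      simp only [map_add, map_smul, LinearMap.add_apply, LinearMap.smul_apply]
      module

theorem smul [IsTopologicalAddGroup A] [ContinuousSMul ℝ A] [IsTopologicalAddGroup B]
    [ContinuousSMul ℝ B] {c : A → ℝ}
    (hc : QuotDiffOn n c U) (hf : QuotDiffOn n f U) : QuotDiffOn n (fun x => c x • f x) U :=
  bilin (LinearMap.lsmul ℝ B) continuous_smul hc hf

end QuotDiffOn

/-! ### Uniqueness of difference quotients. -/

section Quotient

variable [IsTopologicalAddGroup A] [ContinuousSMul ℝ A] [T2Space B]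

/-- For `t ≠ 0` one divides by `t`; the values at `t = 0` are limits of these, since the domain is
open. -/
theorem eqOn_quotDomain_of_smul_eq (hU : IsOpen U) {g g' : A × A × ℝ → B}
    (hg : ContinuousOn g (quotDomain U)) (hg' : ContinuousOn g' (quotDomain U))
    (h : ∀ x h, ∀ t : ℝ, x ∈ U → x + t • h ∈ U → t • g (x, h, t) = t • g' (x, h, t)) :
    EqOn g g' (quotDomain U) := by
  have hne : ∀ x h, ∀ t : ℝ, t ≠ 0 → (x, h, t) ∈ quotDomain U → g (x, h, t) = g' (x, h, t) :=
    fun x v t ht hz => smul_right_injective B ht (h x v t hz.1 hz.2)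
  rintro ⟨x, v, t⟩ hz
  by_cases ht : t = 0
  · subst ht
    have hc : ContinuousAt (fun t : ℝ => (x, v, t)) 0 := by fun_prop
    have hnhds := (isOpen_quotDomain hU).mem_nhds hz
    have h1 : Tendsto (fun t : ℝ => g (x, v, t)) (𝓝[≠] 0) (𝓝 (g (x, v, 0))) :=
      ((hg.continuousAt hnhds).comp (f := fun t : ℝ => (x, v, t)) hc).tendsto.mono_left nhdsWithin_le_nhds
    have h2 : Tendsto (fun t : ℝ => g' (x, v, t)) (𝓝[≠] 0) (𝓝 (g' (x, v, 0))) :=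
      ((hg'.continuousAt hnhds).comp (f := fun t : ℝ => (x, v, t)) hc).tendsto.mono_left nhdsWithin_le_nhds
    refine tendsto_nhds_unique (h1.congr' ?_) h2
    filter_upwards [self_mem_nhdsWithin, mem_nhdsWithin_of_mem_nhds (hc.preimage_mem_nhds hnhds)]
      with t ht htz using hne x v t ht htz
  · exact hne x v t ht hz

/-- Each order `n` provides its own quotient; by uniqueness the one of order 1 serves for all `n`.
-/
theorem exists_quotient (hU : IsOpen U) (hf : ∀ n, QuotDiffOn n f U) :
    ∃ g : A × A × ℝ → B, (∀ n, QuotDiffOn n g (quotDomain U)) ∧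
      ∀ x h, ∀ t : ℝ, x ∈ U → x + t • h ∈ U → f (x + t • h) = f x + t • g (x, h, t) := by
  obtain ⟨_, g, hg, hfg⟩ := hf 1
  refine ⟨g, fun n => ?_, hfg⟩
  obtain ⟨_, g', hg', hfg'⟩ := hf (n + 1)
  refine hg'.congr (eqOn_quotDomain_of_smul_eq hU hg.continuousOn hg'.continuousOn ?_)
  intro x h t hx hxt
  exact add_left_cancel ((hfg x h t hx hxt).symm.trans (hfg' x h t hx hxt))

end Quotient

end DifferenceQuotients

end

/-! ### From continuous difference quotients to Keller smoothness. -/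

noncomputable section

section KellerSmooth

variable {A B : Type} [AddCommGroup A] [Module ℝ A] [TopologicalSpace A] [IsTopologicalAddGroup A]
  [ContinuousSMul ℝ A] [AddCommGroup B] [Module ℝ B] [TopologicalSpace B]
  {U : Set A} {f : A → B} {g : A × A × ℝ → B}

omit [AddCommGroup B] [Module ℝ B] in
theorem tendsto_of_quotient (hU : IsOpen U) (hg : ContinuousOn g (quotDomain U)) {x : A}
    (hx : x ∈ U) (h : A) : Tendsto (fun t : ℝ => g (x, h, t)) (𝓝[≠] 0) (𝓝 (g (x, h, 0))) := by
  have hc : ContinuousAt (fun t : ℝ => (x, h, t)) 0 := by fun_prop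
  have hz : (x, h, (0 : ℝ)) ∈ quotDomain U := ⟨hx, by simpa using hx⟩
  exact ((hg.continuousAt ((isOpen_quotDomain hU).mem_nhds hz)).comp (f := fun t : ℝ => (x, h, t))
    hc).tendsto.mono_left nhdsWithin_le_nhds

theorem eventually_add_smul_mem (hU : IsOpen U) {x : A} (hx : x ∈ U) (h : A) :
    ∀ᶠ t : ℝ in 𝓝[≠] 0, x + t • h ∈ U := by
  have hc : ContinuousAt (fun t : ℝ => x + t • h) 0 := by fun_prop
  exact mem_nhdsWithin_of_mem_nhds (hc.preimage_mem_nhds (hU.mem_nhds (by simpa using hx)))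

theorem tendsto_inv_smul_sub (hU : IsOpen U) (hg : ContinuousOn g (quotDomain U))
    (hfg : ∀ x h, ∀ t : ℝ, x ∈ U → x + t • h ∈ U → f (x + t • h) = f x + t • g (x, h, t))
    {x : A} (hx : x ∈ U) (h : A) :
    Tendsto (fun t : ℝ => t⁻¹ • (f (x + t • h) - f x)) (𝓝[≠] 0) (𝓝 (g (x, h, 0))) := by
  refine (tendsto_of_quotient hU hg hx h).congr' ?_
  filter_upwards [self_mem_nhdsWithin, eventually_add_smul_mem hU hx h] with t ht hxt
  rw [hfg x h t hx hxt, add_sub_cancel_left, inv_smul_smul₀ ht]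

variable [IsTopologicalAddGroup B] [ContinuousSMul ℝ B] [T2Space B]

-- The step from `x` to `x + t (h + k)` is split at `x + t h`. Continuity of `g` at the moving base
-- point makes the second quotient converge to `g (x, k, 0)`.
omit [ContinuousSMul ℝ B] in
theorem quotient_zero_add (hU : IsOpen U) (hg : ContinuousOn g (quotDomain U))
    (hfg : ∀ x h, ∀ t : ℝ, x ∈ U → x + t • h ∈ U → f (x + t • h) = f x + t • g (x, h, t))
    {x : A} (hx : x ∈ U) (h k : A) : g (x, h + k, 0) = g (x, h, 0) + g (x, k, 0) := by
  have hc : ContinuousAt (fun t : ℝ => (x + t • h, k, t)) 0 := by fun_prop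
  have hz : (x + (0 : ℝ) • h, k, (0 : ℝ)) ∈ quotDomain U := ⟨by simpa using hx, by simpa using hx⟩
  have h2 : Tendsto (fun t : ℝ => g (x + t • h, k, t)) (𝓝[≠] 0) (𝓝 (g (x, k, 0))) := by
    have := ((hg.continuousAt ((isOpen_quotDomain hU).mem_nhds hz)).comp
      (f := fun t : ℝ => (x + t • h, k, t)) hc).tendsto.mono_left
      (nhdsWithin_le_nhds (s := {0}ᶜ))
    simpa [Function.comp_def] using this
  refine tendsto_nhds_unique (tendsto_of_quotient hU hg hx (h + k))
    (((tendsto_of_quotient hU hg hx h).add h2).congr' ?_)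
  filter_upwards [self_mem_nhdsWithin, eventually_add_smul_mem hU hx h,
    eventually_add_smul_mem hU hx (h + k)] with t ht hxh hxhk
  have heq : x + t • h + t • k = x + t • (h + k) := by rw [smul_add, add_assoc]
  have e1 := hfg _ k t hxh (by rwa [heq])
  rw [heq, hfg _ _ t hx hxhk, hfg _ _ t hx hxh, add_assoc, ← smul_add] at e1
  exact (smul_right_injective B ht (add_left_cancel e1)).symm

omit [IsTopologicalAddGroup B] in
theorem quotient_zero_smul (hU : IsOpen U) (hg : ContinuousOn g (quotDomain U))
    (hfg : ∀ x h, ∀ t : ℝ, x ∈ U → x + t • h ∈ U → f (x + t • h) = f x + t • g (x, h, t))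
    {x : A} (hx : x ∈ U) (c : ℝ) (h : A) : g (x, c • h, 0) = c • g (x, h, 0) := by
  have hc : ContinuousAt (fun t : ℝ => (x, h, t * c)) 0 := by fun_prop
  have hz : (x, h, (0 : ℝ) * c) ∈ quotDomain U := ⟨hx, by simpa using hx⟩
  have h2 : Tendsto (fun t : ℝ => g (x, h, t * c)) (𝓝[≠] 0) (𝓝 (g (x, h, 0))) := by
    have := ((hg.continuousAt ((isOpen_quotDomain hU).mem_nhds hz)).comp
      (f := fun t : ℝ => (x, h, t * c)) hc).tendsto.mono_left
      (nhdsWithin_le_nhds (s := {0}ᶜ))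
    simpa [Function.comp_def] using this
  refine tendsto_nhds_unique (tendsto_of_quotient hU hg hx (c • h)) ((h2.const_smul c).congr' ?_)
  filter_upwards [self_mem_nhdsWithin, eventually_add_smul_mem hU hx (c • h)] with t ht hxh
  have e1 := hfg _ _ t hx hxh
  rw [smul_smul] at hxh
  rw [smul_smul, hfg _ _ (t * c) hx hxh, mul_smul] at e1
  exact smul_right_injective B ht (add_left_cancel e1)

-- The differential of order `l` is regarded as a function of point and directions together, so that
-- it again falls under `QuotDiffOn`. The next one is its derivative in the direction `(h, 0)`,
-- which moves the point and fixes the directions.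
omit [ContinuousSMul ℝ B] [IsTopologicalAddGroup B] in
theorem exists_differential (hU : IsOpen U) {l : ℕ} {f : A × (Fin l → A) → B}
    (hf : ∀ n, QuotDiffOn n f (U ×ˢ univ)) :
    ∃ (f' : A × (Fin (l + 1) → A) → B)
      (g : (A × (Fin l → A)) × (A × (Fin l → A)) × ℝ → B),
      (∀ n, QuotDiffOn n f' (U ×ˢ univ)) ∧ ContinuousOn g (quotDomain (U ×ˢ univ)) ∧
      (∀ x h, ∀ t : ℝ, x ∈ U ×ˢ univ → x + t • h ∈ U ×ˢ univ →
        f (x + t • h) = f x + t • g (x, h, t)) ∧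
      ∀ z, f' z = g ((z.1, Fin.init z.2), (z.2 (Fin.last l), 0), 0) := by
  obtain ⟨g, hg, hfg⟩ := exists_quotient (hU.prod isOpen_univ) hf
  refine ⟨fun z => g ((z.1, Fin.init z.2), (z.2 (Fin.last l), 0), 0), g, fun n => ?_,
    (hg 0).continuousOn, hfg, fun _ => rfl⟩
  have h1 : QuotDiffOn n (fun z : A × (Fin (l + 1) → A) => (Fin.init z.2 : Fin l → A))
      (U ×ˢ univ) :=
    QuotDiffOn.clm ((ContinuousLinearMap.pi fun i : Fin l =>
      ContinuousLinearMap.proj (R := ℝ) (φ := fun _ : Fin (l + 1) => A) i.castSucc).comp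
      (ContinuousLinearMap.snd ℝ A (Fin (l + 1) → A)))
  have h2 : QuotDiffOn n (fun z : A × (Fin (l + 1) → A) => z.2 (Fin.last l)) (U ×ˢ univ) :=
    QuotDiffOn.clm ((ContinuousLinearMap.proj (R := ℝ) (φ := fun _ : Fin (l + 1) => A)
      (Fin.last l)).comp (ContinuousLinearMap.snd ℝ A (Fin (l + 1) → A)))
  refine (hg n).comp ((QuotDiffOn.id.fst.prodMk h1).prodMk
    ((h2.prodMk (QuotDiffOn.const 0)).prodMk (QuotDiffOn.const 0))) fun z hz => ?_
  exact ⟨⟨hz.1, mem_univ _⟩, by simpa using hz.1⟩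

omit [ContinuousSMul ℝ B] [IsTopologicalAddGroup B] in
theorem exists_differential_sequence (hU : IsOpen U) (hf : ∀ n, QuotDiffOn n f U) :
    ∃ (F : (l : ℕ) → A × (Fin l → A) → B)
      (G : (l : ℕ) → (A × (Fin l → A)) × (A × (Fin l → A)) × ℝ → B),
      (∀ z, F 0 z = f z.1) ∧ (∀ l, ContinuousOn (F l) (U ×ˢ univ)) ∧
      (∀ l, ContinuousOn (G l) (quotDomain (U ×ˢ univ))) ∧
      (∀ l x h, ∀ t : ℝ, x ∈ U ×ˢ univ → x + t • h ∈ U ×ˢ univ →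
        F l (x + t • h) = F l x + t • G l (x, h, t)) ∧
      ∀ l z, F (l + 1) z = G l ((z.1, Fin.init z.2), (z.2 (Fin.last l), 0), 0) := by
  -- The recursion carries the differentiability of each stage, which is what produces the next one.
  let F : (l : ℕ) → {F : A × (Fin l → A) → B // ∀ n, QuotDiffOn n F (U ×ˢ univ)} := fun l =>
    Nat.rec ⟨fun z => f z.1, fun n => (hf n).comp QuotDiffOn.id.fst fun z hz => hz.1⟩
      (fun l F => ⟨(exists_differential hU F.2).choose,
        (exists_differential hU F.2).choose_spec.choose_spec.1⟩) l
  exact ⟨fun l => (F l).1, fun l => (exists_differential hU (F l).2).choose_spec.choose,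
    fun _ => rfl, fun l => ((F l).2 0).continuousOn,
    fun l => (exists_differential hU (F l).2).choose_spec.choose_spec.2.1,
    fun l => (exists_differential hU (F l).2).choose_spec.choose_spec.2.2.1,
    fun l => (exists_differential hU (F l).2).choose_spec.choose_spec.2.2.2⟩

-- One has `F (x + v, u) - F (x, u) = τ • G ((x, u), (τ⁻¹ • v, 0), τ)`. Since `G` is continuous and
-- vanishes at `((x, 0), (0, 0), 0)`, its value lies in a given neighbourhood as soon as `u`, `τ⁻¹ •
-- v` and `τ` are small. The bound on `u` does not depend on `ε`; only that on `v` does, through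
-- `τ`. This is Keller's order of quantifiers.
omit [IsTopologicalAddGroup B] in
theorem exists_forall_sub_eq_smul {l : ℕ} {F : A × (Fin l → A) → B}
    {G : (A × (Fin l → A)) × (A × (Fin l → A)) × ℝ → B} (hU : IsOpen U)
    (hG : ContinuousOn G (quotDomain (U ×ˢ univ)))
    (hFG : ∀ x h, ∀ t : ℝ, x ∈ U ×ˢ univ → x + t • h ∈ U ×ˢ univ →
        F (x + t • h) = F x + t • G (x, h, t)) {x : A} (hx : x ∈ U) {W : Set B}
    (hW : W ∈ 𝓝 0) :
    ∃ N ∈ 𝓝 (0 : A), ∀ ε : ℝ, 0 < ε → ∃ V ∈ 𝓝 (0 : A), ∀ v ∈ V, x + v ∈ U →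
      ∀ u : Fin l → A, (∀ i, u i ∈ N) → ∃ w ∈ W, F (x + v, u) - F (x, u) = ε • w := by
  obtain ⟨W', ⟨hW', hbal⟩, hWW⟩ := (nhds_basis_balanced ℝ B).mem_iff.1 hW
  have hxU : (x, (0 : Fin l → A)) ∈ U ×ˢ (univ : Set (Fin l → A)) := ⟨hx, mem_univ _⟩
  have hzero : G ((x, 0), (0, 0), 0) = 0 := by
    have := quotient_zero_smul (hU.prod isOpen_univ) hG hFG hxU 0 0
    rwa [zero_smul, zero_smul] at this
  have hcont : ContinuousAt G ((x, 0), 0, 0) :=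
    hG.continuousAt ((isOpen_quotDomain (hU.prod isOpen_univ)).mem_nhds
      ⟨hxU, by simpa using hx⟩)
  have hj : Continuous fun z : (Fin l → A) × A × ℝ =>
      (((x, z.1), (z.2.1, (0 : Fin l → A)), z.2.2) :
        (A × (Fin l → A)) × (A × (Fin l → A)) × ℝ) := by fun_prop
  have hev : ∀ᶠ z : (Fin l → A) × A × ℝ in 𝓝 (0, 0, 0),
      G ((x, z.1), (z.2.1, 0), z.2.2) ∈ W' :=
    (hcont.comp_of_eq (f := fun z : (Fin l → A) × A × ℝ =>
      (((x, z.1), (z.2.1, (0 : Fin l → A)), z.2.2) :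
        (A × (Fin l → A)) × (A × (Fin l → A)) × ℝ)) (x := (0, 0, 0)) hj.continuousAt rfl
          ).preimage_mem_nhds (by simpa [hzero] using hW')
  rw [nhds_prod_eq, nhds_prod_eq] at hev
  obtain ⟨N₁, hN₁, S, hS, hNS⟩ := mem_prod_iff.1 hev
  obtain ⟨N₂, hN₂, R, hR, hNR⟩ := mem_prod_iff.1 hS
  rw [nhds_pi] at hN₁
  obtain ⟨I, t, ht, htN⟩ := Filter.mem_pi'.1 hN₁
  obtain ⟨δ, hδ, hδR⟩ := Metric.mem_nhds_iff.1 hR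
  refine ⟨(⋂ i, t i) ∩ N₂, inter_mem (iInter_mem.2 ht) hN₂, fun ε hε => ?_⟩
  -- `τ ≤ ε` lets the balanced set `W'` absorb the factor `τ / ε`; `τ < δ` keeps the parameter in
  -- `R`.
  set τ := min ε (δ / 2) with hτ
  have hτ0 : 0 < τ := lt_min hε (half_pos hδ)
  refine ⟨(fun v => τ⁻¹ • v) ⁻¹' N₂, ?_, fun v hv hxv u hu => ?_⟩
  · exact (continuous_const_smul τ⁻¹).continuousAt.preimage_mem_nhds (by simpa using hN₂)
  have hmem : G ((x, u), (τ⁻¹ • v, 0), τ) ∈ W' := by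
    refine hNS (a := (u, τ⁻¹ • v, τ)) ⟨htN fun i _ => mem_iInter.1 (hu i).1 i, hNR ⟨hv, hδR ?_⟩⟩
    rw [Metric.mem_ball, Real.dist_eq, sub_zero, abs_of_pos hτ0]
    exact (min_le_right _ _).trans_lt (half_lt_self hδ)
  have heq : (x, u) + τ • (τ⁻¹ • v, (0 : Fin l → A)) = (x + v, u) := by
    simp [smul_smul, hτ0.ne']
  have h1 := hFG (x, u) (τ⁻¹ • v, 0) τ ⟨hx, mem_univ _⟩ (by rw [heq]; exact ⟨hxv, mem_univ _⟩)
  refine ⟨(τ / ε) • G ((x, u), (τ⁻¹ • v, 0), τ), hWW (hbal.smul_mem ?_ hmem), ?_⟩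
  · rw [Real.norm_eq_abs, abs_of_pos (by positivity), div_le_one hε]
    exact min_le_left _ _
  · rw [heq] at h1
    rw [h1, add_sub_cancel_left, smul_smul, mul_div_cancel₀ _ hε.ne']

/-- A function having continuous iterated difference quotients of all orders on an open set is a
Keller smooth map. -/
theorem isKellerSmooth_of_quotDiffOn [LocallyConvexSpace ℝ A] [T2Space A]
    [LocallyConvexSpace ℝ B] (hU : IsOpen U) (hf : ∀ n, QuotDiffOn n f U) :
    IsKellerSmooth {w : A × B | w.1 ∈ U ∧ w.2 = f w.1} := by
  classical
  obtain ⟨F, G, hF0, hFc, hGc, hFG, hF'⟩ := exists_differential_sequence hU hf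
  have hUo (l : ℕ) : IsOpen (U ×ˢ (univ : Set (Fin l → A))) := hU.prod isOpen_univ
  have hvar (l : ℕ) {x : A} (hx : x ∈ U) (u : Fin l → A) (h : A) :
      Tendsto (fun t : ℝ => t⁻¹ • (F l (x + t • h, u) - F l (x, u))) (𝓝[≠] 0)
        (𝓝 (F (l + 1) (x, Fin.snoc (α := fun _ => A) u h))) := by
    have := tendsto_inv_smul_sub (hUo l) (hGc l) (hFG l) (x := (x, u)) ⟨hx, mem_univ _⟩ (h, 0)
    simpa [hF'] using this
  have hlin (l : ℕ) {x : A} (hx : x ∈ U) : ∀ (u : Fin l → A) (i : Fin l),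
      (∀ a b, F l (x, Function.update u i (a + b)) =
        F l (x, Function.update u i a) + F l (x, Function.update u i b)) ∧
      ∀ (c : ℝ) a, F l (x, Function.update u i (c • a)) = c • F l (x, Function.update u i a) := by
    induction l generalizing x with
    | zero => exact fun _ i => i.elim0
    | succ l ih =>
      intro u i
      -- In the last slot, linearity is that of a directional derivative. In the other slots it
      -- passes to the limit from order `l`, at both `x` and `x + t • h`.
      refine Fin.lastCases ?_ (fun j => ?_) i
      · have hz : (x, (Fin.init u : Fin l → A)) ∈ U ×ˢ (univ : Set (Fin l → A)) :=
          ⟨hx, mem_univ _⟩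
        simp only [hF', Fin.init_update_last, Function.update_self]
        refine ⟨fun a b => ?_, fun c a => ?_⟩
        · simpa using quotient_zero_add (hUo l) (hGc l) (hFG l) hz (a, 0) (b, 0)
        · simpa using quotient_zero_smul (hUo l) (hGc l) (hFG l) hz c (a, 0)
      · have hsnoc (a : A) : Function.update u j.castSucc a =
            Fin.snoc (α := fun _ => A) (Function.update (Fin.init u) j a) (u (Fin.last l)) := by
          rw [Fin.snoc_update, Fin.snoc_init_self]
        simp only [hsnoc]
        have hU' := eventually_add_smul_mem hU hx (u (Fin.last l))
        refine ⟨fun a b => ?_, fun c a => ?_⟩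
        · refine tendsto_nhds_unique (hvar l hx _ _)
            (((hvar l hx _ _).add (hvar l hx _ _)).congr' ?_)
          filter_upwards [hU'] with t ht
          rw [(ih ht _ _).1, (ih hx _ _).1]
          module
        · refine tendsto_nhds_unique (hvar l hx _ _) (((hvar l hx _ _).const_smul c).congr' ?_)
          filter_upwards [hU'] with t ht
          rw [(ih ht _ _).2, (ih hx _ _).2]
          module
  -- Multilinearity is known only over `U`; elsewhere the value 0 is a harmless default.
  let D (l : ℕ) (x : A) : ContinuousMultilinearMap ℝ (fun _ : Fin l => A) B :=
    if hx : x ∈ U then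
      { toFun := fun u => F l (x, u)
        map_update_add' := fun {d} u i a b => by
          rw [Subsingleton.elim d (instDecidableEqFin l)]
          convert! (hlin l hx u i).1 a b using 1
        map_update_smul' := fun {d} u i c a => by
          rw [Subsingleton.elim d (instDecidableEqFin l)]
          convert! (hlin l hx u i).2 c a using 1
        cont := (hFc l).comp_continuous (f := fun u => (x, u)) (by fun_prop)
          fun u => ⟨hx, mem_univ _⟩ }
    else 0
  have hD (l : ℕ) {x : A} (hx : x ∈ U) (u : Fin l → A) : D l x u = F l (x, u) := by
    simp only [D, dif_pos hx]
    rfl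
  refine ⟨U, D, hU, ?_, ?_, ?_⟩
  · ext w
    simp only [mem_ofPred_eq]
    refine and_congr_right fun hw => ?_
    rw [hD 0 hw, hF0]
  · intro l x hx u h
    rw [hD (l + 1) hx]
    refine (hvar l hx u h).congr' ?_
    filter_upwards [eventually_add_smul_mem hU hx h] with t ht
    rw [hD l hx, hD l ht]
  · intro l x hx W hW
    obtain ⟨N, hN, h⟩ := exists_forall_sub_eq_smul hU (hGc l) (hFG l) hx hW
    refine ⟨N, hN, fun ε hε => ?_⟩
    obtain ⟨V, hV, hV'⟩ := h ε hε
    refine ⟨V, hV, fun v hv hxv u hu => ?_⟩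
    rw [hD l hxv, hD l hx]
    exact hV' v hv hxv u hu

end KellerSmooth

end

noncomputable section

/-! Operators on function spaces over the cylinder. -/

instance : Fact (IsClosed (univ : Set ℝ)) := ⟨isClosed_univ⟩

instance (T : ℝ) : Fact (IsClosed (strip T)) := ⟨isClosed_Icc.prod isClosed_univ⟩

instance (T : ℝ) : Fact (IsClosed (slab T)) := ⟨isClosed_Icc.prod isClosed_univ⟩

instance (p : ℝ) : Fact (∀ q, q + p ∈ (univ : Set ℝ) ↔ q ∈ (univ : Set ℝ)) := ⟨by simp⟩

instance (T : ℝ) : Fact (∀ q, q + (0, 1) ∈ strip T ↔ q ∈ strip T) := ⟨by simp [strip]⟩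

instance (T : ℝ) : Fact (∀ q, q + (0, 1, 0) ∈ slab T ↔ q ∈ slab T) := ⟨by simp [slab]⟩

theorem convex_strip (T : ℝ) : Convex ℝ (strip T) := (convex_Icc 0 T).prod convex_univ

theorem mem_strip {T t η : ℝ} : (t, η) ∈ strip T ↔ t ∈ Icc 0 T := by simp [strip]

theorem mem_slab {T t η z : ℝ} : (t, η, z) ∈ slab T ↔ t ∈ Icc 0 T := by simp [slab]

theorem mem_slab_of_mem_strip {T : ℝ} {q : ℝ × ℝ} (hq : q ∈ strip T) (z : ℝ) :
    (q.1, q.2, z) ∈ slab T := mem_slab.2 hq.1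

theorem strip_nonempty (T : ℝ) [hT : Fact (0 < T)] : (strip T).Nonempty :=
  ⟨(0, 0), mem_strip.2 ⟨le_rfl, hT.out.le⟩⟩

/-- The integral of `g` along the characteristic `τ ↦ (τ, η - t + τ)`, for `τ` between `0` and
`t`. -/
def charIntegral (g : ℝ × ℝ → ℝ) (q : ℝ × ℝ) : ℝ :=
  q.1 * ∫ σ : unitInterval, g (σ * q.1, q.2 - q.1 + σ * q.1)

theorem charIntegral_eq_intervalIntegral (g : ℝ × ℝ → ℝ) (t η : ℝ) :
    charIntegral g (t, η) = ∫ τ in (0 : ℝ)..t, g (τ, η - t + τ) := by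
  have := intervalIntegral.mul_integral_comp_mul_right (a := 0) (b := 1)
    (f := fun τ => g (τ, η - t + τ)) t
  rw [zero_mul, one_mul] at this
  rw [← this, ← unitInterval.integral_eq_intervalIntegral fun s => g (s * t, η - t + s * t)]
  rfl

theorem charPath_mem_strip {T : ℝ} {q : ℝ × ℝ} (hq : q ∈ strip T) (σ : unitInterval) :
    ((σ * q.1, q.2 - q.1 + σ * q.1) : ℝ × ℝ) ∈ strip T :=
  mem_strip.2 ⟨mul_nonneg σ.2.1 hq.1.1,
    (mul_le_of_le_one_left hq.1.1 σ.2.2).trans hq.1.2⟩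

theorem charIntegral_congr {T : ℝ} {g g' : ℝ × ℝ → ℝ} (h : EqOn g g' (strip T)) :
    EqOn (charIntegral g) (charIntegral g') (strip T) := fun q hq => by
  unfold charIntegral
  congr 2
  funext σ
  exact h (charPath_mem_strip hq σ)

theorem charIntegral_const_mul (c : ℝ) (g : ℝ × ℝ → ℝ) (q : ℝ × ℝ) :
    charIntegral (fun r => c * g r) q = c * charIntegral g q := by
  unfold charIntegral
  rw [MeasureTheory.integral_const_mul]
  ring

theorem charIntegral_add {T : ℝ} {g g' : ℝ × ℝ → ℝ} (hg : ContinuousOn g (strip T))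
    (hg' : ContinuousOn g' (strip T)) {q : ℝ × ℝ} (hq : q ∈ strip T) :
    charIntegral (fun r => g r + g' r) q = charIntegral g q + charIntegral g' q := by
  have hint {g : ℝ × ℝ → ℝ} (hg : ContinuousOn g (strip T)) :
      MeasureTheory.Integrable fun σ : unitInterval => g (σ * q.1, q.2 - q.1 + σ * q.1) :=
    (hg.comp_continuous (f := fun σ : unitInterval => (σ * q.1, q.2 - q.1 + σ * q.1))
      (by fun_prop) (charPath_mem_strip hq)).integrable_of_hasCompactSupport
        (HasCompactSupport.of_compactSpace _)
  unfold charIntegral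
  rw [MeasureTheory.integral_add (hint hg) (hint hg')]
  ring

theorem charIntegral_periodic {g : ℝ × ℝ → ℝ} (hg : ∀ q, g (q + (0, 1)) = g q) (q : ℝ × ℝ) :
    charIntegral g (q + (0, 1)) = charIntegral g q := by
  unfold charIntegral
  simp only [Prod.fst_add, Prod.snd_add, add_zero]
  congr 2
  funext σ
  rw [← hg (σ * q.1, q.2 - q.1 + σ * q.1)]
  congr 1
  ext
  · simp
  · simp only [Prod.snd_add]
    ring

/-- The solution of the linear equation `w(t, η) = k(η - t) + ∫₀ᵗ (a w + b)(τ, η - t + τ) dτ`. -/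
def linSolution (k : ℝ → ℝ) (a b : ℝ × ℝ → ℝ) (q : ℝ × ℝ) : ℝ :=
  Real.exp (charIntegral a q) *
    (k (q.2 - q.1) + charIntegral (fun r => Real.exp (-charIntegral a r) * b r) q)

/-- Joint homogeneity in the initial value and the source extracts the factor `t` (or `δ`) from a
difference of solutions. -/
theorem linSolution_const_mul (c : ℝ) (k : ℝ → ℝ) (a b : ℝ × ℝ → ℝ) (q : ℝ × ℝ) :
    linSolution (fun ξ => c * k ξ) a (fun r => c * b r) q = c * linSolution k a b q := by
  unfold linSolution
  have h : (fun r => Real.exp (-charIntegral a r) * (c * b r)) =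
      fun r => c * (Real.exp (-charIntegral a r) * b r) := funext fun r => mul_left_comm _ _ _
  rw [h, charIntegral_const_mul, ← mul_add, mul_left_comm]

theorem linSolution_congr {T : ℝ} {k k' : ℝ → ℝ} {a a' b b' : ℝ × ℝ → ℝ} (hk : ∀ ξ, k ξ = k' ξ)
    (ha : EqOn a a' (strip T)) (hb : EqOn b b' (strip T)) :
    EqOn (linSolution k a b) (linSolution k' a' b') (strip T) := fun q hq => by
  unfold linSolution
  rw [charIntegral_congr ha hq, hk]
  congr 2
  refine charIntegral_congr (fun r hr => ?_) hq
  rw [charIntegral_congr ha hr, hb hr]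

theorem linSolution_zero (a : ℝ × ℝ → ℝ) (q : ℝ × ℝ) : linSolution 0 a 0 q = 0 := by
  have := linSolution_const_mul 0 0 a 0 q
  simpa [Pi.zero_def] using this

variable {T : ℝ}

section Families

variable {X : Type*} [TopologicalSpace X] {m : ℕ}

/-- The characteristic is parametrized over the fixed interval `[0, 1]`, so `q` enters only through
the integrand and the prefactor. -/
theorem ContDiffFamilyOn.charIntegral {g : X → ℝ × ℝ → ℝ} (hg : ContDiffFamilyOn (strip T) m g) :
    ContDiffFamilyOn (strip T) m fun x => charIntegral (g x) := by
  refine (ContDiffFamilyOn.of_clm (ContinuousLinearMap.fst ℝ ℝ ℝ)).mul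
    (ContDiffFamilyOn.integral (X := X) (I := unitInterval) MeasureTheory.volume
      (f := fun z q => g z.1 (z.2 * q.1, q.2 - q.1 + z.2 * q.1)) (convex_strip T) ?_)
  have h1 : ContDiffFamilyOn (strip T) m
      fun (z : X × unitInterval) (q : ℝ × ℝ) => (z.2 : ℝ) * q.1 :=
    (ContDiffFamilyOn.of_continuous (by fun_prop)).mul
      (ContDiffFamilyOn.of_clm (ContinuousLinearMap.fst ℝ ℝ ℝ))
  have h2 : ContDiffFamilyOn (strip T) m fun (_ : X × unitInterval) (q : ℝ × ℝ) => q.2 - q.1 :=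
    ContDiffFamilyOn.of_clm (ContinuousLinearMap.snd ℝ ℝ ℝ - ContinuousLinearMap.fst ℝ ℝ ℝ)
  exact (hg.comp_param continuous_fst).comp (h1.prodMk (h2.add h1))
    fun z q hq => charPath_mem_strip hq z.2

theorem ContDiffFamilyOn.exp {V : Type} [NormedAddCommGroup V] [NormedSpace ℝ V] {Q : Set V}
    {g : X → V → ℝ} (hg : ContDiffFamilyOn Q m g) :
    ContDiffFamilyOn Q m fun x q => Real.exp (g x q) :=
  (Real.contDiff_exp.contDiffOn.contDiffFamilyOn uniqueDiffOn_univ).comp hg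
    fun _ => mapsTo_univ _ _

theorem ContDiffFamilyOn.linSolution {k : X → ℝ → ℝ} {a b : X → ℝ × ℝ → ℝ}
    (hk : ContDiffFamilyOn univ m k) (ha : ContDiffFamilyOn (strip T) m a)
    (hb : ContDiffFamilyOn (strip T) m b) :
    ContDiffFamilyOn (strip T) m fun x => linSolution (k x) (a x) (b x) := by
  have h2 : ContDiffFamilyOn (strip T) m fun (_ : X) (q : ℝ × ℝ) => q.2 - q.1 :=
    ContDiffFamilyOn.of_clm (ContinuousLinearMap.snd ℝ ℝ ℝ - ContinuousLinearMap.fst ℝ ℝ ℝ)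
  exact ha.charIntegral.exp.mul ((hk.comp h2 fun _ => mapsTo_univ _ _).add
    (ha.charIntegral.neg.exp.mul hb).charIntegral)

variable [hT : Fact (0 < T)]

theorem ContDiffFamilyOn.superposition {φ : X → SmoothNonlinearity T} (hφ : Continuous φ)
    {y : X → ℝ × ℝ → ℝ} (hy : ContDiffFamilyOn (strip T) m y) :
    ContDiffFamilyOn (strip T) m fun x q => φ x (q.1, q.2, y x q) :=
  ((SmoothSpace.contDiffFamilyOn_eval m).comp_param hφ).comp
    ((ContDiffFamilyOn.of_clm (ContinuousLinearMap.fst ℝ ℝ ℝ)).prodMk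
      ((ContDiffFamilyOn.of_clm (ContinuousLinearMap.snd ℝ ℝ ℝ)).prodMk hy))
    fun _ _ hq => mem_slab_of_mem_strip hq _

/-- The partial derivative `φ_z` of a nonlinearity `φ(t, θ, z)`. -/
def partialState : SmoothNonlinearity T →L[ℝ] SmoothNonlinearity T :=
  SmoothSpace.dirDerivCLM (0, 0, 1)

/-- The partial derivative `φ_θ` of a nonlinearity `φ(t, θ, z)`. -/
def partialAngle : SmoothNonlinearity T →L[ℝ] SmoothNonlinearity T :=
  SmoothSpace.dirDerivCLM (0, 1, 0)

/-- The mean slope of `φ(q, ·)` between `y₁ q` and `y₂ q`. -/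
def meanSlope (φ : SmoothNonlinearity T) (y₁ y₂ : ℝ × ℝ → ℝ) (q : ℝ × ℝ) : ℝ :=
  ∫ σ : unitInterval, partialState φ (q.1, q.2, y₁ q + σ * (y₂ q - y₁ q))

/-- This linearizes the difference of nonlinear terms exactly. Being an integral and not a quotient,
the slope stays regular where `y₁` and `y₂` coincide. -/
theorem sub_eq_mul_meanSlope (φ : SmoothNonlinearity T) (y₁ y₂ : ℝ × ℝ → ℝ) {q : ℝ × ℝ}
    (hq : q ∈ strip T) :
    φ (q.1, q.2, y₂ q) - φ (q.1, q.2, y₁ q) = (y₂ q - y₁ q) * meanSlope φ y₁ y₂ q := by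
  have := φ.sub_eq_mul_integral_dirDeriv (q := (q.1, q.2, y₁ q)) (e := (0, 0, 1))
    (fun s => by simpa using mem_slab_of_mem_strip hq _) (y₂ q - y₁ q)
  simpa [meanSlope, partialState] using this

theorem angle_sub_eq_mul_integral (φ : SmoothNonlinearity T) {q : ℝ × ℝ} (hq : q ∈ strip T)
    (z δ : ℝ) : φ (q.1, q.2 + δ, z) - φ (q.1, q.2, z) =
      δ * ∫ σ : unitInterval, partialAngle φ (q.1, q.2 + σ * δ, z) := by
  have := φ.sub_eq_mul_integral_dirDeriv (q := (q.1, q.2, z)) (e := (0, 1, 0))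
    (fun s => by simpa using mem_slab.2 hq.1) δ
  simpa [partialAngle] using this

theorem ContDiffFamilyOn.meanSlope {φ : X → SmoothNonlinearity T} (hφ : Continuous φ)
    {y₁ y₂ : X → ℝ × ℝ → ℝ} (hy₁ : ContDiffFamilyOn (strip T) m y₁)
    (hy₂ : ContDiffFamilyOn (strip T) m y₂) :
    ContDiffFamilyOn (strip T) m fun x => meanSlope (φ x) (y₁ x) (y₂ x) := by
  refine ContDiffFamilyOn.integral (X := X) (I := unitInterval) MeasureTheory.volume
    (f := fun z q => partialState (φ z.1) (q.1, q.2, y₁ z.1 q + z.2 * (y₂ z.1 q - y₁ z.1 q)))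
    (convex_strip T) ?_
  have hy₁' := hy₁.comp_param (continuous_fst (X := X) (Y := unitInterval))
  have hy₂' := hy₂.comp_param (continuous_fst (X := X) (Y := unitInterval))
  exact superposition (partialState.continuous.comp (hφ.comp continuous_fst))
    (hy₁'.add ((ContDiffFamilyOn.of_continuous (by fun_prop)).mul (hy₂'.sub hy₁')))

end Families

end

/-! ### Smooth operators on `C^∞([0, T] × S¹)`. -/

noncomputable section

variable {T : ℝ} [hT : Fact (0 < T)]

theorem SmoothSpace.continuous_eval {V : Type} [NormedAddCommGroup V] [NormedSpace ℝ V]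
    [ProperSpace V] {Q : Set V} {p : V} [Fact (UniqueDiffOn ℝ Q)] [Fact (IsClosed Q)] {q : V}
    (hq : q ∈ Q) : Continuous fun f : SmoothSpace Q p => f q :=
  (SmoothSpace.contDiffFamilyOn_eval 0).continuousOn.comp_continuous
    (f := fun f : SmoothSpace Q p => (f, q)) (by fun_prop) fun _ => ⟨mem_univ _, hq⟩

namespace SmoothCylinder

section Average

theorem exists_average {X : Type*} [TopologicalSpace X] {g : X × ℝ → SmoothCylinder T}
    (hg : Continuous g) : ∃ G : X → SmoothCylinder T, Continuous G ∧
      ∀ x, ∀ q ∈ strip T, G x q = ∫ σ : unitInterval, g (x, σ) q := by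
  refine SmoothSpace.exists_continuous_of_contDiffFamilyOn (fun m => ?_) fun x q _ => ?_
  · exact ContDiffFamilyOn.integral (X := X) (I := unitInterval) MeasureTheory.volume
      (f := fun z q => g (z.1, z.2) q) (convex_strip T)
      ((SmoothSpace.contDiffFamilyOn_eval m).comp_param
        (hg.comp (f := fun z : X × unitInterval => (z.1, (z.2 : ℝ))) (by fun_prop)))
  · simp only [SmoothSpace.periodic]

open Classical in
/-- The mean value over `[0, 1]` of a continuous curve of functions. -/
def average (g : ℝ → SmoothCylinder T) : SmoothCylinder T :=
  if hg : Continuous g then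
    (exists_average (X := Unit) (g := fun z => g z.2) (hg.comp continuous_snd)).choose () else 0

theorem average_apply {g : ℝ → SmoothCylinder T} (hg : Continuous g) {q : ℝ × ℝ}
    (hq : q ∈ strip T) : average g q = ∫ σ : unitInterval, g σ q := by
  rw [average, dif_pos hg]
  exact (exists_average (X := Unit) (g := fun z => g z.2)
    (hg.comp continuous_snd)).choose_spec.2 () q hq

theorem continuous_average {X : Type*} [TopologicalSpace X] {g : X × ℝ → SmoothCylinder T}
    (hg : Continuous g) : Continuous fun x => average fun s => g (x, s) := by
  obtain ⟨G, hG, hG'⟩ := exists_average hg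
  convert hG using 1
  funext x
  refine SmoothSpace.ext fun q hq => ?_
  rw [hG' x q hq, average_apply (by fun_prop) hq]

/-- The quotient of an average is the average of the quotients in the direction `(h, 0)`. The
integration variable ranges over all of `ℝ` so that `f` is defined on a subset of a vector space. -/
theorem quotDiffOn_average {A : Type} [AddCommGroup A] [Module ℝ A] [TopologicalSpace A] {n : ℕ}
    {U : Set A} {f : A × ℝ → SmoothCylinder T} (hf : QuotDiffOn n f (U ×ˢ univ)) :
    QuotDiffOn n (fun x => average fun s => f (x, s)) U := by
  have hcont {A : Type} [AddCommGroup A] [Module ℝ A] [TopologicalSpace A] {n : ℕ}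
      {U : Set A} {f : A × ℝ → SmoothCylinder T} (hf : QuotDiffOn n f (U ×ˢ univ)) :
      ContinuousOn (fun x => average fun s => f (x, s)) U := by
    rw [continuousOn_iff_continuous_domRestrict]
    refine continuous_average (X := U) (g := fun z => f (z.1, z.2)) ?_
    exact hf.continuousOn.comp_continuous (f := fun z : U × ℝ => ((z.1 : A), z.2)) (by fun_prop)
      fun z => ⟨z.1.2, mem_univ _⟩
  have hslice {A : Type} [AddCommGroup A] [Module ℝ A] [TopologicalSpace A] {n : ℕ}
      {U : Set A} {f : A × ℝ → SmoothCylinder T} (hf : QuotDiffOn n f (U ×ˢ univ)) {x : A}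
      (hx : x ∈ U) : Continuous fun s => f (x, s) :=
    hf.continuousOn.comp_continuous (f := fun s : ℝ => (x, s)) (by fun_prop)
      fun z => ⟨hx, mem_univ _⟩
  induction n generalizing A with
  | zero => exact hcont hf
  | succ n ih =>
    have hf1 := hf
    obtain ⟨_, g, hg, hfg⟩ := hf
    have hg' : QuotDiffOn n (fun z : (A × A × ℝ) × ℝ => g ((z.1.1, z.2), (z.1.2.1, 0), z.1.2.2))
        (quotDomain U ×ˢ univ) := by
      have h1 : QuotDiffOn n (fun z : (A × A × ℝ) × ℝ => z.1) (quotDomain U ×ˢ univ) :=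
        QuotDiffOn.id.fst
      refine hg.comp ((h1.fst.prodMk QuotDiffOn.id.snd).prodMk
        ((h1.snd.fst.prodMk (QuotDiffOn.const 0)).prodMk h1.snd.snd)) fun z hz => ?_
      exact ⟨⟨hz.1.1, mem_univ _⟩, ⟨hz.1.2, mem_univ _⟩⟩
    refine ⟨hcont hf1, _, ih hg', fun x h t hx hxt => SmoothSpace.ext fun q hq => ?_⟩
    have hs := hslice hg' (x := (x, h, t)) ⟨hx, hxt⟩
    have hint {u : ℝ → SmoothCylinder T} (hu : Continuous u) :
        MeasureTheory.Integrable fun σ : unitInterval => u σ q :=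
      ((SmoothSpace.continuous_eval hq).comp
        (hu.comp continuous_subtype_val)).integrable_of_hasCompactSupport
          (HasCompactSupport.of_compactSpace _)
    rw [SmoothSpace.add_apply, SmoothSpace.smul_apply, average_apply (hslice hf1 hxt) hq,
      average_apply (hslice hf1 hx) hq, average_apply hs hq, ← MeasureTheory.integral_const_mul,
      ← MeasureTheory.integral_add (hint (hslice hf1 hx)) ((hint hs).const_mul t)]
    congr 1
    funext σ
    have := hfg (x, σ) (h, 0) t ⟨hx, mem_univ _⟩ ⟨hxt, mem_univ _⟩
    simp only [Prod.smul_mk, Prod.mk_add_mk, smul_zero, add_zero] at this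
    rw [this, SmoothSpace.add_apply, SmoothSpace.smul_apply]

end Average

section Multiplication

theorem exists_mul : ∃ G : SmoothCylinder T × SmoothCylinder T → SmoothCylinder T,
    Continuous G ∧ ∀ x, ∀ q ∈ strip T, G x q = x.1 q * x.2 q :=
  SmoothSpace.exists_continuous_of_contDiffFamilyOn
    (fun m => ((SmoothSpace.contDiffFamilyOn_eval m).comp_param continuous_fst).mul
      ((SmoothSpace.contDiffFamilyOn_eval m).comp_param continuous_snd))
    fun x q _ => by simp only [SmoothSpace.periodic]

/-- Pointwise multiplication. -/
def mulL : SmoothCylinder T →ₗ[ℝ] SmoothCylinder T →ₗ[ℝ] SmoothCylinder T :=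
  LinearMap.mk₂ ℝ (fun f g => exists_mul.choose (f, g))
    (fun f f' g => SmoothSpace.ext fun q hq => by
      simp only [SmoothSpace.add_apply, exists_mul.choose_spec.2 _ q hq, add_mul])
    (fun c f g => SmoothSpace.ext fun q hq => by
      simp only [SmoothSpace.smul_apply, exists_mul.choose_spec.2 _ q hq, mul_assoc])
    (fun f g g' => SmoothSpace.ext fun q hq => by
      simp only [SmoothSpace.add_apply, exists_mul.choose_spec.2 _ q hq, mul_add])
    (fun c f g => SmoothSpace.ext fun q hq => by
      simp only [SmoothSpace.smul_apply, exists_mul.choose_spec.2 _ q hq, mul_left_comm])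

theorem mulL_apply (f g : SmoothCylinder T) {q : ℝ × ℝ} (hq : q ∈ strip T) :
    mulL f g q = f q * g q := exists_mul.choose_spec.2 (f, g) q hq

theorem continuous_mulL :
    Continuous fun z : SmoothCylinder T × SmoothCylinder T => mulL z.1 z.2 :=
  exists_mul.choose_spec.1

end Multiplication

section Transport

theorem exists_transport : ∃ G : SmoothCircle → SmoothCylinder T,
    Continuous G ∧ ∀ k, ∀ q ∈ strip T, G k q = k (q.2 - q.1) := by
  refine SmoothSpace.exists_continuous_of_contDiffFamilyOn (fun m => ?_) fun k q _ => ?_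
  · exact (SmoothSpace.contDiffFamilyOn_eval m).comp (ContDiffFamilyOn.of_clm
      (ContinuousLinearMap.snd ℝ ℝ ℝ - ContinuousLinearMap.fst ℝ ℝ ℝ)) fun _ => mapsTo_univ _ _
  · rw [← k.periodic (q.2 - q.1)]
    refine congrArg (k : ℝ → ℝ) ?_
    simp only [Prod.fst_add, Prod.snd_add]
    ring

/-- The solution `(t, η) ↦ k (η - t)` of the homogeneous transport equation. -/
def transport : SmoothCircle →L[ℝ] SmoothCylinder T where
  toFun := exists_transport.choose
  map_add' f g := SmoothSpace.ext fun q hq => by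
    simp only [SmoothSpace.add_apply, exists_transport.choose_spec.2 _ q hq]
  map_smul' c f := SmoothSpace.ext fun q hq => by
    simp only [SmoothSpace.smul_apply, exists_transport.choose_spec.2 _ q hq, RingHom.id_apply]
  cont := exists_transport.choose_spec.1

theorem transport_apply (k : SmoothCircle) {q : ℝ × ℝ} (hq : q ∈ strip T) :
    transport (T := T) k q = k (q.2 - q.1) := exists_transport.choose_spec.2 k q hq

theorem exists_charInt : ∃ G : SmoothCylinder T → SmoothCylinder T,
    Continuous G ∧ ∀ f, ∀ q ∈ strip T, G f q = charIntegral f q :=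
  SmoothSpace.exists_continuous_of_contDiffFamilyOn
    (fun m => (SmoothSpace.contDiffFamilyOn_eval m).charIntegral)
    fun f q _ => charIntegral_periodic f.periodic q

/-- Integration along characteristics. -/
def charInt : SmoothCylinder T →L[ℝ] SmoothCylinder T where
  toFun := exists_charInt.choose
  map_add' f g := SmoothSpace.ext fun q hq => by
    simp only [SmoothSpace.add_apply, exists_charInt.choose_spec.2 _ q hq]
    exact charIntegral_add f.continuousOn g.continuousOn hq
  map_smul' c f := SmoothSpace.ext fun q hq => by
    simp only [SmoothSpace.smul_apply, exists_charInt.choose_spec.2 _ q hq, RingHom.id_apply]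
    exact charIntegral_const_mul c f q
  cont := exists_charInt.choose_spec.1

theorem charInt_apply (f : SmoothCylinder T) {q : ℝ × ℝ} (hq : q ∈ strip T) :
    charInt f q = charIntegral f q := exists_charInt.choose_spec.2 f q hq

end Transport

section Superposition

omit hT in
theorem nonlinearity_periodic (φ : SmoothNonlinearity T) (q : ℝ × ℝ) (z : ℝ) :
    φ ((q + (0, 1)).1, (q + (0, 1)).2, z) = φ (q.1, q.2, z) := by
  rw [← φ.periodic (q.1, q.2, z)]
  simp

theorem exists_superpose : ∃ G : SmoothNonlinearity T × SmoothCylinder T → SmoothCylinder T,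
    Continuous G ∧ ∀ x, ∀ q ∈ strip T, G x q = x.1 (q.1, q.2, x.2 q) :=
  SmoothSpace.exists_continuous_of_contDiffFamilyOn
    (fun m => ContDiffFamilyOn.superposition continuous_fst
      ((SmoothSpace.contDiffFamilyOn_eval m).comp_param continuous_snd))
    fun x q _ => by rw [SmoothSpace.periodic, nonlinearity_periodic]

/-- The superposition operator, `(φ, y) ↦ φ(·, ·, y)`. -/
def superpose (x : SmoothNonlinearity T × SmoothCylinder T) : SmoothCylinder T :=
  exists_superpose.choose x

theorem superpose_apply (x : SmoothNonlinearity T × SmoothCylinder T) {q : ℝ × ℝ}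
    (hq : q ∈ strip T) : superpose x q = x.1 (q.1, q.2, x.2 q) :=
  exists_superpose.choose_spec.2 x q hq

theorem continuous_superpose :
    Continuous (superpose : SmoothNonlinearity T × SmoothCylinder T → SmoothCylinder T) :=
  exists_superpose.choose_spec.1

/-- The mean slope of a nonlinearity between two functions on the cylinder. -/
def slope (φ : SmoothNonlinearity T) (y₁ y₂ : SmoothCylinder T) : SmoothCylinder T :=
  average fun s => superpose (partialState φ, y₁ + s • (y₂ - y₁))

theorem slope_apply (φ : SmoothNonlinearity T) (y₁ y₂ : SmoothCylinder T) {q : ℝ × ℝ}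
    (hq : q ∈ strip T) : slope φ y₁ y₂ q = meanSlope φ y₁ y₂ q := by
  have hc : Continuous fun s : ℝ => superpose (partialState φ, y₁ + s • (y₂ - y₁)) :=
    continuous_superpose.comp (by fun_prop)
  rw [slope, average_apply hc hq]
  simp only [superpose_apply _ hq]
  rfl

variable {A : Type} [AddCommGroup A] [Module ℝ A] [TopologicalSpace A] [IsTopologicalAddGroup A]
  [ContinuousSMul ℝ A] {n : ℕ} {U : Set A}

/-- The regularity of `superpose` is kept as a hypothesis of order `n`, since this lemma is used
inside the induction that proves it. -/
theorem quotDiffOn_slope_of_superpose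
    (h : QuotDiffOn n (superpose : _ → SmoothCylinder T) univ)
    {φ : A → SmoothNonlinearity T} {y₁ y₂ : A → SmoothCylinder T} (hφ : QuotDiffOn n φ U)
    (hy₁ : QuotDiffOn n y₁ U) (hy₂ : QuotDiffOn n y₂ U) :
    QuotDiffOn n (fun x => slope (φ x) (y₁ x) (y₂ x)) U := by
  have hfst : QuotDiffOn n (fun z : A × ℝ => z.1) (U ×ˢ univ) := QuotDiffOn.id.fst
  have hm : MapsTo (fun z : A × ℝ => z.1) (U ×ˢ univ) U := fun z hz => hz.1
  refine quotDiffOn_average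
    (f := fun z => superpose (partialState (φ z.1), y₁ z.1 + z.2 • (y₂ z.1 - y₁ z.1))) ?_
  refine h.comp (((hφ.comp hfst hm).clm_comp partialState).prodMk ((hy₁.comp hfst hm).add
    (QuotDiffOn.id.snd.smul ((hy₂.comp hfst hm).sub (hy₁.comp hfst hm))))) (mapsTo_univ _ _)

/-- `(φ + t ψ)(y + t v) - φ(y) = t (ψ(y + t v) + slope φ y (y + t v) * v)`. The slope involves only
superposition with `∂_z φ`, which depends on `φ` continuously and linearly, so order `n` of
`superpose` yields order `n` of its quotient. -/
theorem quotDiffOn_superpose_univ (n : ℕ) :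
    QuotDiffOn n (superpose : SmoothNonlinearity T × SmoothCylinder T → _) univ := by
  induction n with
  | zero => exact continuous_superpose.continuousOn
  | succ n ih =>
    refine ⟨continuous_superpose.continuousOn, fun z =>
      superpose (z.2.1.1, z.1.2 + z.2.2 • z.2.1.2) +
        mulL (slope z.1.1 z.1.2 (z.1.2 + z.2.2 • z.2.1.2)) z.2.1.2, ?_,
        fun x h t _ _ => SmoothSpace.ext fun q hq => ?_⟩
    · have h1 : QuotDiffOn n (fun z : (SmoothNonlinearity T × SmoothCylinder T) ×
          (SmoothNonlinearity T × SmoothCylinder T) × ℝ => z) (quotDomain univ) := QuotDiffOn.id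
      have h2 := h1.fst.snd.add (h1.snd.snd.smul h1.snd.fst.snd)
      exact (ih.comp (h1.snd.fst.fst.prodMk h2) (mapsTo_univ _ _)).add
        (QuotDiffOn.bilin mulL continuous_mulL
          (quotDiffOn_slope_of_superpose ih h1.fst.fst h1.fst.snd h2) h1.snd.fst.snd)
    · have h3 := sub_eq_mul_meanSlope x.1 x.2 (x.2 + t • h.2 : SmoothCylinder T) hq
      simp only [SmoothSpace.add_apply, SmoothSpace.smul_apply, superpose_apply _ hq,
        mulL_apply _ _ hq, slope_apply _ _ _ hq, Prod.fst_add, Prod.snd_add, Prod.smul_fst,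
        Prod.smul_snd] at h3 ⊢
      linear_combination h3

omit [IsTopologicalAddGroup A] [ContinuousSMul ℝ A] in
theorem quotDiffOn_superpose {φ : A → SmoothNonlinearity T} {y : A → SmoothCylinder T}
    (hφ : QuotDiffOn n φ U) (hy : QuotDiffOn n y U) :
    QuotDiffOn n (fun x => superpose (φ x, y x)) U :=
  (quotDiffOn_superpose_univ n).comp (hφ.prodMk hy) (mapsTo_univ _ _)

theorem quotDiffOn_slope {φ : A → SmoothNonlinearity T} {y₁ y₂ : A → SmoothCylinder T}
    (hφ : QuotDiffOn n φ U) (hy₁ : QuotDiffOn n y₁ U) (hy₂ : QuotDiffOn n y₂ U) :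
    QuotDiffOn n (fun x => slope (φ x) (y₁ x) (y₂ x)) U :=
  quotDiffOn_slope_of_superpose (quotDiffOn_superpose_univ n) hφ hy₁ hy₂

/-- The nonlinearity `exp z`. -/
def expNonlinearity : SmoothNonlinearity T :=
  SmoothSpace.ofContDiffOn (fun q => Real.exp q.2.2) (by fun_prop) fun q _ => by simp

omit hT in
theorem expNonlinearity_apply {q : ℝ × ℝ × ℝ} (hq : q ∈ slab T) :
    expNonlinearity (T := T) q = Real.exp q.2.2 := by
  rw [expNonlinearity, SmoothSpace.ofContDiffOn_apply hq]

theorem superpose_exp_apply (y : SmoothCylinder T) {q : ℝ × ℝ} (hq : q ∈ strip T) :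
    superpose (expNonlinearity, y) q = Real.exp (y q) := by
  rw [superpose_apply _ hq]
  exact expNonlinearity_apply (mem_slab_of_mem_strip hq _)

/-- The solution operator of the linear transport equation. -/
def linSol (k : SmoothCircle) (a b : SmoothCylinder T) : SmoothCylinder T :=
  mulL (superpose (expNonlinearity, charInt a))
    (transport k + charInt (mulL (superpose (expNonlinearity, -charInt a)) b))

theorem linSol_apply (k : SmoothCircle) (a b : SmoothCylinder T) {q : ℝ × ℝ} (hq : q ∈ strip T) :
    linSol k a b q = linSolution k a b q := by
  rw [linSol, mulL_apply _ _ hq, superpose_exp_apply _ hq, charInt_apply _ hq,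
    SmoothSpace.add_apply, transport_apply _ hq, charInt_apply _ hq, linSolution]
  congr 2
  refine charIntegral_congr (fun r hr => ?_) hq
  rw [mulL_apply _ _ hr, superpose_exp_apply _ hr, SmoothSpace.neg_apply, charInt_apply _ hr]

theorem quotDiffOn_linSol {k : A → SmoothCircle} {a b : A → SmoothCylinder T}
    (hk : QuotDiffOn n k U) (ha : QuotDiffOn n a U) (hb : QuotDiffOn n b U) :
    QuotDiffOn n (fun x => linSol (k x) (a x) (b x)) U := by
  have hJ := ha.clm_comp charInt
  exact QuotDiffOn.bilin mulL continuous_mulL (quotDiffOn_superpose (QuotDiffOn.const _) hJ)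
    ((hk.clm_comp transport).add (QuotDiffOn.clm_comp charInt
      (QuotDiffOn.bilin mulL continuous_mulL
        (quotDiffOn_superpose (QuotDiffOn.const _) hJ.neg) hb)))

end Superposition

end SmoothCylinder

end

noncomputable section

/-! Solutions of the transport equation: comparison, uniqueness and regularity. -/

theorem exists_continuous_extension {T : ℝ} (hT : 0 ≤ T) {g : ℝ → ℝ}
    (hg : ContinuousOn g (Icc 0 T)) : ∃ g' : ℝ → ℝ, Continuous g' ∧ EqOn g' g (Icc 0 T) :=
  ⟨IccExtend hT ((Icc 0 T).domRestrict g), hg.domRestrict.Icc_extend',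
    fun _ ht => IccExtend_of_mem hT _ ht⟩

theorem intervalIntegral_congr_Icc {T t : ℝ} (ht : t ∈ Icc 0 T) {g g' : ℝ → ℝ}
    (h : EqOn g g' (Icc 0 T)) : ∫ τ in (0 : ℝ)..t, g τ = ∫ τ in (0 : ℝ)..t, g' τ :=
  intervalIntegral.integral_congr fun τ hτ => h (by
    rw [uIcc_of_le ht.1] at hτ
    exact ⟨hτ.1, hτ.2.trans ht.2⟩)

/-- A continuous extension of `g` beyond `[0, T]` makes the two-sided fundamental theorem of
calculus available at the end points. -/
theorem hasDerivWithinAt_Icc_of_eq_integral {T : ℝ} {g u : ℝ → ℝ} {c : ℝ}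
    (hg : ContinuousOn g (Icc 0 T)) (hu : ∀ t ∈ Icc 0 T, u t = c + ∫ τ in (0 : ℝ)..t, g τ)
    {t : ℝ} (ht : t ∈ Icc 0 T) : HasDerivWithinAt u (g t) (Icc 0 T) t := by
  obtain ⟨g', hg', heq⟩ := exists_continuous_extension (ht.1.trans ht.2) hg
  have h1 : HasDerivAt (fun t => c + ∫ τ in (0 : ℝ)..t, g' τ) (g' t) t :=
    (hg'.integral_hasStrictDerivAt 0 t).hasDerivAt.const_add c
  rw [← heq ht]
  have h2 : ∀ s ∈ Icc 0 T, u s = c + ∫ τ in (0 : ℝ)..s, g' τ := fun s hs => by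
    rw [hu s hs, intervalIntegral_congr_Icc hs heq]
  exact h1.hasDerivWithinAt.congr h2 (h2 t ht)

/-- Integrating factor: `exp (-∫ α) * w - ∫ exp (-∫ α) * β` has derivative zero on `[0, T]` and
starts at `κ`. -/
theorem eq_exp_mul_of_eq_integral {T κ : ℝ} {α β w : ℝ → ℝ} (hα : ContinuousOn α (Icc 0 T))
    (hβ : ContinuousOn β (Icc 0 T)) (hw : ContinuousOn w (Icc 0 T))
    (h : ∀ t ∈ Icc 0 T, w t = κ + ∫ τ in (0 : ℝ)..t, (α τ * w τ + β τ)) {t : ℝ}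
    (ht : t ∈ Icc 0 T) :
    w t = Real.exp (∫ τ in (0 : ℝ)..t, α τ) *
      (κ + ∫ τ in (0 : ℝ)..t, Real.exp (-∫ s in (0 : ℝ)..τ, α s) * β τ) := by
  have hT : 0 ≤ T := ht.1.trans ht.2
  obtain ⟨α', hα', hαα⟩ := exists_continuous_extension hT hα
  obtain ⟨β', hβ', hββ⟩ := exists_continuous_extension hT hβ
  have hA (s : ℝ) : HasDerivAt (fun s => ∫ τ in (0 : ℝ)..s, α' τ) (α' s) s :=
    (hα'.integral_hasStrictDerivAt 0 s).hasDerivAt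
  have hAc : Continuous fun s => ∫ τ in (0 : ℝ)..s, α' τ :=
    continuous_iff_continuousAt.2 fun s => (hA s).continuousAt
  have hHc : Continuous fun s => Real.exp (-∫ τ in (0 : ℝ)..s, α' τ) * β' s := by fun_prop
  have hH (s : ℝ) := (hHc.integral_hasStrictDerivAt 0 s).hasDerivAt
  have hw' {s : ℝ} (hs : s ∈ Icc 0 T) : HasDerivWithinAt w (α' s * w s + β' s) (Icc 0 T) s := by
    rw [hαα hs, hββ hs]
    exact hasDerivWithinAt_Icc_of_eq_integral ((hα.mul hw).add hβ) h hs
  have hd {s : ℝ} (hs : s ∈ Icc 0 T) : HasDerivWithinAt (fun s =>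
      Real.exp (-∫ τ in (0 : ℝ)..s, α' τ) * w s -
        ∫ τ in (0 : ℝ)..s, Real.exp (-∫ r in (0 : ℝ)..τ, α' r) * β' τ) 0 (Icc 0 T) s := by
    convert! (((hA s).neg.exp.hasDerivWithinAt (s := Icc 0 T)).mul (hw' hs)).sub
      ((hH s).hasDerivWithinAt (s := Icc 0 T)) using 1
    simp only [Pi.neg_apply]
    ring
  have hconst := constant_of_has_deriv_right_zero (fun s hs => (hd hs).continuousWithinAt)
    (fun s hs => ((hd (Ico_subset_Icc_self hs)).mono_of_mem_nhdsWithin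
      (Icc_mem_nhdsGE_of_mem hs))) t ht
  have h0 : w 0 = κ := by simpa using h 0 ⟨le_rfl, hT⟩
  have hint : ∀ s ∈ Icc 0 T, ∫ τ in (0 : ℝ)..s, α' τ = ∫ τ in (0 : ℝ)..s, α τ :=
    fun s hs => intervalIntegral_congr_Icc hs hαα
  have hint2 : ∫ τ in (0 : ℝ)..t, Real.exp (-∫ r in (0 : ℝ)..τ, α' r) * β' τ =
      ∫ τ in (0 : ℝ)..t, Real.exp (-∫ r in (0 : ℝ)..τ, α r) * β τ :=
    intervalIntegral_congr_Icc ht fun s hs => by simp only [hint s hs, hββ hs]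
  simp only [intervalIntegral.integral_same, neg_zero, Real.exp_zero, one_mul, sub_zero, h0,
    hint t ht, hint2] at hconst
  rw [← hconst, sub_add_cancel, ← mul_assoc, ← Real.exp_add, add_neg_cancel, Real.exp_zero,
    one_mul]

variable {T : ℝ}

theorem ContinuousOn.comp_characteristic {g : ℝ × ℝ → ℝ} (hg : ContinuousOn g (strip T)) (ξ : ℝ) :
    ContinuousOn (fun τ => g (τ, ξ + τ)) (Icc 0 T) :=
  hg.comp (f := fun τ => (τ, ξ + τ)) (by fun_prop) fun _ hτ => mem_strip.2 hτ

theorem eqOn_linSolution {k : ℝ → ℝ} {a b w : ℝ × ℝ → ℝ} (ha : ContinuousOn a (strip T))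
    (hb : ContinuousOn b (strip T)) (hw : ContinuousOn w (strip T))
    (h : ∀ q ∈ strip T, w q = k (q.2 - q.1) + charIntegral (fun r => a r * w r + b r) q) :
    EqOn w (linSolution k a b) (strip T) := by
  rintro ⟨t, η⟩ hq
  have := eq_exp_mul_of_eq_integral (κ := k (η - t)) (ha.comp_characteristic (η - t))
    (hb.comp_characteristic (η - t)) (hw.comp_characteristic (η - t)) (fun s hs => by
      rw [h _ (mem_strip.2 hs), charIntegral_eq_intervalIntegral]
      simp only [add_sub_cancel_right]) (mem_strip.1 hq)
  simp only [sub_add_cancel] at this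
  rw [this, linSolution, charIntegral_eq_intervalIntegral, charIntegral_eq_intervalIntegral]
  simp only [charIntegral_eq_intervalIntegral, add_sub_cancel_right]

variable [hT : Fact (0 < T)]

/-- `y` is a continuous solution of the transport equation, in its integrated form. -/
def IsTransportSolution (k : SmoothCircle) (φ : SmoothNonlinearity T) (y : ℝ × ℝ → ℝ) : Prop :=
  ContinuousOn y (strip T) ∧
    ∀ q ∈ strip T, y q = k (q.2 - q.1) + charIntegral (fun r => φ (r.1, r.2, y r)) q

omit hT in
theorem ContinuousOn.superposition (φ : SmoothNonlinearity T) {y : ℝ × ℝ → ℝ}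
    (hy : ContinuousOn y (strip T)) : ContinuousOn (fun q => φ (q.1, q.2, y q)) (strip T) :=
  φ.continuousOn.comp (continuousOn_fst.prodMk (continuousOn_snd.prodMk hy))
    fun _ hq => mem_slab_of_mem_strip hq _

omit hT in
theorem contDiffFamilyOn_unit_zero {g : ℝ × ℝ → ℝ} (hg : ContinuousOn g (strip T)) :
    ContDiffFamilyOn (strip T) 0 fun _ : Unit => g :=
  hg.comp continuousOn_snd fun _ hz => hz.2

theorem ContinuousOn.meanSlope (φ : SmoothNonlinearity T) {y₁ y₂ : ℝ × ℝ → ℝ}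
    (hy₁ : ContinuousOn y₁ (strip T)) (hy₂ : ContinuousOn y₂ (strip T)) :
    ContinuousOn (meanSlope φ y₁ y₂) (strip T) := by
  have := (ContDiffFamilyOn.meanSlope (X := Unit) (φ := fun _ => φ) continuous_const
    (contDiffFamilyOn_unit_zero hy₁) (contDiffFamilyOn_unit_zero hy₂)).continuousOn
  exact this.comp (f := fun q => ((), q)) (by fun_prop) fun q hq => ⟨mem_univ _, hq⟩

/-- The difference of two solutions of transport equations solves a linear transport equation. -/
theorem IsTransportSolution.sub_eq_linSolution {k : SmoothCircle} {φ : SmoothNonlinearity T}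
    {y₁ : ℝ × ℝ → ℝ} (h₁ : IsTransportSolution k φ y₁) {k₂ : ℝ → ℝ} {y₂ g : ℝ × ℝ → ℝ}
    (hy₂ : ContinuousOn y₂ (strip T)) (hg : ContinuousOn g (strip T))
    (h₂ : ∀ q ∈ strip T, y₂ q = k₂ (q.2 - q.1) + charIntegral g q) {q : ℝ × ℝ}
    (hq : q ∈ strip T) :
    y₂ q - y₁ q = linSolution (fun ξ => k₂ ξ - k ξ) (meanSlope φ y₁ y₂)
      (fun r => g r - φ (r.1, r.2, y₂ r)) q := by
  refine eqOn_linSolution (w := fun q => y₂ q - y₁ q) (h₁.1.meanSlope φ hy₂)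
    (b := fun r => g r - φ (r.1, r.2, y₂ r)) (hg.sub (hy₂.superposition φ)) (hy₂.sub h₁.1) (fun q hq => ?_) hq
  -- The mismatch `g - φ(y₂)` is the source of the linear equation, because `g - φ(y₁) = slope * (y₂
  -- - y₁) + (g - φ(y₂))`.
  have hcongr : charIntegral (fun r => meanSlope φ y₁ y₂ r * (y₂ r - y₁ r) +
      (g r - φ (r.1, r.2, y₂ r))) q = charIntegral (fun r => g r + -1 * φ (r.1, r.2, y₁ r)) q :=
    charIntegral_congr (fun r hr => by
      have := sub_eq_mul_meanSlope φ y₁ y₂ hr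
      linear_combination -this) hq
  rw [hcongr, charIntegral_add (g' := fun r => -1 * φ (r.1, r.2, y₁ r)) hg
    (continuousOn_const.mul (h₁.1.superposition φ)) hq,
    charIntegral_const_mul, h₁.2 q hq, h₂ q hq]
  ring

/-- The difference solves a linear equation with zero data, and its explicit solution is zero. -/
theorem IsTransportSolution.eqOn {k : SmoothCircle} {φ : SmoothNonlinearity T}
    {y₁ y₂ : ℝ × ℝ → ℝ} (h₁ : IsTransportSolution k φ y₁) (h₂ : IsTransportSolution k φ y₂) :
    EqOn y₂ y₁ (strip T) := fun q hq => by
  have := h₁.sub_eq_linSolution h₂.1 (h₂.1.superposition φ) h₂.2 hq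
  simp only [sub_self] at this
  exact sub_eq_zero.1 (this.trans (linSolution_zero _ q))

theorem meanSlope_self (φ : SmoothNonlinearity T) (y : ℝ × ℝ → ℝ) (q : ℝ × ℝ) :
    meanSlope φ y y q = partialState φ (q.1, q.2, y q) := by
  simp [meanSlope]

omit hT in
theorem charIntegral_shift (g : ℝ × ℝ → ℝ) (t η δ : ℝ) :
    charIntegral g (t, η + δ) = charIntegral (fun r => g (r.1, r.2 + δ)) (t, η) := by
  unfold charIntegral
  simp only
  congr 2
  funext σ
  congr 2
  ring

/-- The derivative in the circle variable of a solution of the transport equation. -/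
def angleDeriv (k : SmoothCircle) (φ : SmoothNonlinearity T) (y : ℝ × ℝ → ℝ) : ℝ × ℝ → ℝ :=
  linSolution (SmoothSpace.dirDerivCLM (1 : ℝ) k) (fun q => partialState φ (q.1, q.2, y q))
    fun q => partialAngle φ (q.1, q.2, y q)

/-- The translate by `δ` solves the problem with translated data. The difference is thus a
`linSolution`, and Hadamard's formula for `k` and for `φ` in the angle exhibits `δ` as a factor of
its data. The remaining factor `G` is continuous also at `δ = 0`, although `y` is only assumed
continuous. -/
theorem IsTransportSolution.exists_angle_quotient {k : SmoothCircle} {φ : SmoothNonlinearity T}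
    {y : ℝ × ℝ → ℝ} (h : IsTransportSolution k φ y) :
    ∃ G : ℝ → ℝ × ℝ → ℝ, ContinuousOn (fun z : ℝ × (ℝ × ℝ) => G z.1 z.2) (univ ×ˢ strip T) ∧
      (∀ δ t η, t ∈ Icc 0 T → y (t, η + δ) - y (t, η) = δ * G δ (t, η)) ∧
      G 0 = angleDeriv k φ y := by
  set k' := SmoothSpace.dirDerivCLM (1 : ℝ) k with hk'
  set yd : ℝ → ℝ × ℝ → ℝ := fun δ q => y (q.1, q.2 + δ) with hyd
  set K : ℝ → ℝ → ℝ := fun δ ξ => ∫ σ : unitInterval, k' (ξ + σ * δ) with hK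
  set B : ℝ → ℝ × ℝ → ℝ := fun δ q =>
    ∫ σ : unitInterval, partialAngle φ (q.1, q.2 + σ * δ, yd δ q) with hB
  have hydc : ContDiffFamilyOn (strip T) 0 yd :=
    h.1.comp (f := fun z : ℝ × (ℝ × ℝ) => (z.2.1, z.2.2 + z.1)) (by fun_prop)
      fun z hz => mem_strip.2 hz.2.1
  have hyc : ContDiffFamilyOn (strip T) 0 fun _ : ℝ => y :=
    h.1.comp continuousOn_snd fun _ hz => hz.2
  have hKc : ContDiffFamilyOn univ 0 K := by
    refine ContDiffFamilyOn.integral (X := ℝ) (I := unitInterval) MeasureTheory.volume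
      (f := fun z ξ => k' (ξ + z.2 * z.1)) convex_univ ?_
    exact k'.continuousOn.comp
      (f := fun z : (ℝ × unitInterval) × ℝ => z.2 + (z.1.2 : ℝ) * z.1.1) (by fun_prop)
      fun _ _ => mem_univ _
  have hBc : ContDiffFamilyOn (strip T) 0 B := by
    refine ContDiffFamilyOn.integral (X := ℝ) (I := unitInterval) MeasureTheory.volume
      (f := fun z q => partialAngle φ (q.1, q.2 + z.2 * z.1, yd z.1 q)) (convex_strip T) ?_
    refine (partialAngle φ).continuousOn.comp
      (f := fun z : (ℝ × unitInterval) × ℝ × ℝ =>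
        (z.2.1, z.2.2 + (z.1.2 : ℝ) * z.1.1, yd z.1.1 z.2)) ?_
      fun z hz => mem_slab.2 hz.2.1
    refine ContinuousOn.prodMk (by fun_prop) (ContinuousOn.prodMk (by fun_prop) ?_)
    exact hydc.continuousOn.comp (f := fun z : (ℝ × unitInterval) × ℝ × ℝ => (z.1.1, z.2))
      (by fun_prop) fun z hz => ⟨mem_univ _, hz.2⟩
  have hφc : Continuous fun _ : ℝ => φ := continuous_const
  refine ⟨fun δ => linSolution (K δ) (meanSlope φ y (yd δ)) (B δ),
    (hKc.linSolution (ContDiffFamilyOn.meanSlope hφc hyc hydc) hBc).continuousOn,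
    fun δ t η ht => ?_, ?_⟩
  · have hydδ : ContinuousOn (yd δ) (strip T) :=
      h.1.comp (f := fun q : ℝ × ℝ => (q.1, q.2 + δ)) (by fun_prop) fun q hq => mem_strip.2 hq.1
    have hg : ContinuousOn (fun q : ℝ × ℝ => φ (q.1, q.2 + δ, yd δ q)) (strip T) :=
      φ.continuousOn.comp (f := fun q : ℝ × ℝ => (q.1, q.2 + δ, yd δ q))
        (ContinuousOn.prodMk (by fun_prop) (ContinuousOn.prodMk (by fun_prop) hydδ))
        fun q hq => mem_slab.2 hq.1
    have h2 := h.sub_eq_linSolution (k₂ := fun ξ => k (ξ + δ)) hydδ hg (fun q hq => by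
      have := h.2 (q.1, q.2 + δ) (mem_strip.2 hq.1)
      rw [charIntegral_shift] at this
      simp only [hyd]
      rw [this]
      simp only
      rw [add_sub_right_comm]) (mem_strip.2 ht : (t, η) ∈ strip T)
    have h3 := linSolution_congr (T := T) (k := fun ξ => k (ξ + δ) - k ξ)
      (k' := fun ξ => δ * K δ ξ) (a := meanSlope φ y (yd δ)) (a' := meanSlope φ y (yd δ))
      (b := fun r => φ (r.1, r.2 + δ, yd δ r) - φ (r.1, r.2, yd δ r)) (b' := fun r => δ * B δ r)
      (fun ξ => by
        have := k.sub_eq_mul_integral_dirDeriv (q := ξ) (e := 1) (fun s => mem_univ _) δ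
        simpa using this) (fun _ _ => rfl)
      (fun r hr => angle_sub_eq_mul_integral φ hr _ δ) (mem_strip.2 ht : (t, η) ∈ strip T)
    rw [h3, linSolution_const_mul] at h2
    exact h2
  · have hK0 : K 0 = k' := by funext ξ; simp [hK]
    have hyd0 : yd 0 = y := by funext q; simp [hyd]
    have hB0 : B 0 = fun q => partialAngle φ (q.1, q.2, y q) := by funext q; simp [hB, hyd0]
    have hA0 : meanSlope φ y y = fun q => partialState φ (q.1, q.2, y q) :=
      funext fun q => meanSlope_self φ y q
    simp only [hK0, hyd0, hB0, hA0]
    rfl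

/-- The total derivative of a solution of the transport equation. -/
def solutionDeriv (k : SmoothCircle) (φ : SmoothNonlinearity T) (y : ℝ × ℝ → ℝ) (q : ℝ × ℝ) :
    ℝ × ℝ →L[ℝ] ℝ :=
  angleDeriv k φ y q • (ContinuousLinearMap.snd ℝ ℝ ℝ - ContinuousLinearMap.fst ℝ ℝ ℝ) +
    φ (q.1, q.2, y q) • ContinuousLinearMap.fst ℝ ℝ ℝ

/-- The path from `q` to `p` follows the characteristic of `q` up to time `p.1`, where the
derivative is `φ`, and then moves in the angle by `(p.2 - q.2) - (p.1 - q.1)`, where `G` is the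
quotient. Each part contributes a remainder `o(p - q)`. -/
theorem IsTransportSolution.hasFDerivWithinAt {k : SmoothCircle} {φ : SmoothNonlinearity T}
    {y : ℝ × ℝ → ℝ} (h : IsTransportSolution k φ y) {q : ℝ × ℝ} (hq : q ∈ strip T) :
    HasFDerivWithinAt y (solutionDeriv k φ y q) (strip T) q := by
  obtain ⟨G, hG, hGy, hG0⟩ := h.exists_angle_quotient
  have hchar : HasDerivWithinAt (fun τ => y (τ, q.2 - q.1 + τ)) (φ (q.1, q.2, y q))
      (Icc 0 T) q.1 := by
    have := hasDerivWithinAt_Icc_of_eq_integral (c := k (q.2 - q.1))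
      ((h.1.superposition φ).comp_characteristic (q.2 - q.1))
      (u := fun τ => y (τ, q.2 - q.1 + τ)) (fun t ht => by
        rw [h.2 _ (mem_strip.2 ht), charIntegral_eq_intervalIntegral]
        simp only [add_sub_cancel_right]) hq.1
    simpa using this
  have hfst : Tendsto (fun p : ℝ × ℝ => p.1) (𝓝[strip T] q) (𝓝[Icc 0 T] q.1) :=
    continuous_fst.continuousWithinAt.tendsto_nhdsWithin fun p hp => hp.1
  have ho1 : (fun p : ℝ × ℝ => y (p.1, q.2 - q.1 + p.1) - y q - (p.1 - q.1) * φ (q.1, q.2, y q))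
      =o[𝓝[strip T] q] fun p => p - q := by
    have h1 := (hasDerivWithinAt_iff_isLittleO.1 hchar).comp_tendsto hfst
    have h2 : (fun p : ℝ × ℝ => p.1 - q.1) =O[𝓝[strip T] q] fun p => p - q :=
      Asymptotics.isBigO_of_le _ fun p => norm_fst_le (p - q)
    simpa [Function.comp_def] using h1.trans_isBigO h2
  have ho2 : (fun p : ℝ × ℝ => (p.2 - q.2 - (p.1 - q.1)) *
      (G (p.2 - q.2 - (p.1 - q.1)) (p.1, q.2 - q.1 + p.1) - G 0 q))
      =o[𝓝[strip T] q] fun p => p - q := by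
    have h1 : (fun p : ℝ × ℝ => p.2 - q.2 - (p.1 - q.1)) =O[𝓝[strip T] q] fun p => p - q :=
      (Asymptotics.isBigO_of_le _ fun p => norm_snd_le (p - q)).sub
        (Asymptotics.isBigO_of_le _ fun p => norm_fst_le (p - q))
    have h2 : Tendsto (fun p : ℝ × ℝ =>
        G (p.2 - q.2 - (p.1 - q.1)) (p.1, q.2 - q.1 + p.1) - G 0 q) (𝓝[strip T] q) (𝓝 0) := by
      have h3 : ContinuousOn (fun p : ℝ × ℝ =>
          G (p.2 - q.2 - (p.1 - q.1)) (p.1, q.2 - q.1 + p.1)) (strip T) :=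
        hG.comp (f := fun p : ℝ × ℝ => (p.2 - q.2 - (p.1 - q.1), (p.1, q.2 - q.1 + p.1)))
          (by fun_prop) fun p hp => ⟨mem_univ _, mem_strip.2 hp.1⟩
      have := (h3 q hq).tendsto.sub_const (G 0 q)
      simpa using this
    simpa using h1.norm_right.mul_isLittleO ((Asymptotics.isLittleO_one_iff ℝ).2 h2)
  refine hasFDerivWithinAt_iff_isLittleO.2 ((ho1.add ho2).congr' ?_ EventuallyEq.rfl)
  filter_upwards [self_mem_nhdsWithin] with p hp
  have h1 := hGy (p.2 - q.2 - (p.1 - q.1)) p.1 (q.2 - q.1 + p.1) hp.1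
  have h2 : q.2 - q.1 + p.1 + (p.2 - q.2 - (p.1 - q.1)) = p.2 := by ring
  rw [h2] at h1
  simp only [solutionDeriv, hG0, _root_.add_apply, _root_.smul_apply,
    _root_.sub_apply, ContinuousLinearMap.coe_fst', ContinuousLinearMap.coe_snd',
    Prod.fst_sub, Prod.snd_sub, smul_eq_mul] at h1 ⊢
  linear_combination -h1

/-- Solutions of the transport equation are smooth, and a jointly continuous family of solutions
has jointly continuous derivatives. -/
theorem contDiffFamilyOn_of_isTransportSolution {X : Type*} [TopologicalSpace X]
    {k : X → SmoothCircle} {φ : X → SmoothNonlinearity T} (hk : Continuous k) (hφ : Continuous φ)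
    {y : X → ℝ × ℝ → ℝ} (hy : ∀ x, IsTransportSolution (k x) (φ x) (y x))
    (hc : ContinuousOn (fun z : X × (ℝ × ℝ) => y z.1 z.2) (univ ×ˢ strip T)) (m : ℕ) :
    ContDiffFamilyOn (strip T) m y := by
  induction m with
  | zero => exact hc
  | succ m ih =>
    -- `solutionDeriv` contains values of `y` but no derivatives of `y`: class `C^m` of the family
    -- gives class `C^m` of its derivative.
    refine ⟨hc, fun x => solutionDeriv (k x) (φ x) (y x),
      fun x q hq => (hy x).hasFDerivWithinAt hq, ?_⟩
    have hk' : ContDiffFamilyOn univ m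
        fun x => (SmoothSpace.dirDerivCLM (1 : ℝ) (k x) : ℝ → ℝ) :=
      (SmoothSpace.contDiffFamilyOn_eval m).comp_param
        ((SmoothSpace.dirDerivCLM (1 : ℝ)).continuous.comp hk)
    exact ((hk'.linSolution (.superposition (partialState.continuous.comp hφ) ih)
      (.superposition (partialAngle.continuous.comp hφ) ih)).smul (.const _)).add
      ((ContDiffFamilyOn.superposition hφ ih).smul (.const _))

end

noncomputable section

/-! Existence and stability of solutions of the transport equation. -/

/-- The factor in Gronwall's estimate for perturbations of an `L`-Lipschitz equation on
`[0, T]`. -/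
def gronwallFactor (L T : ℝ) : ℝ := Real.exp (L * T) + (Real.exp (L * T) - 1) / L

theorem gronwallFactor_pos {L T : ℝ} (hL : 0 < L) (hT : 0 ≤ T) : 0 < gronwallFactor L T := by
  have : 0 ≤ Real.exp (L * T) - 1 := sub_nonneg.2 (Real.one_le_exp (by positivity))
  unfold gronwallFactor
  positivity

/-- Only `f₀` has to be Lipschitz, and `f₁` has to be close to it only along `u₁`. -/
theorem abs_sub_le_mul_gronwallFactor {T d : ℝ} {L : NNReal} (hL : 0 < L) (hd : 0 ≤ d)
    {f₀ f₁ : ℝ → ℝ → ℝ} {u₀ u₁ : ℝ → ℝ} (hf₀ : ∀ t ∈ Icc 0 T, LipschitzWith L (f₀ t))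
    (hu₀ : ∀ t ∈ Icc 0 T, HasDerivWithinAt u₀ (f₀ t (u₀ t)) (Icc 0 T) t)
    (hu₁ : ∀ t ∈ Icc 0 T, HasDerivWithinAt u₁ (f₁ t (u₁ t)) (Icc 0 T) t)
    (hf : ∀ t ∈ Icc 0 T, |f₁ t (u₁ t) - f₀ t (u₁ t)| ≤ d) (h0 : |u₁ 0 - u₀ 0| ≤ d) {t : ℝ}
    (ht : t ∈ Icc 0 T) : |u₁ t - u₀ t| ≤ d * gronwallFactor L T := by
  have hright {u : ℝ → ℝ} {u' : ℝ} {t : ℝ} (ht : t ∈ Ico 0 T)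
      (hu : HasDerivWithinAt u u' (Icc 0 T) t) : HasDerivWithinAt u u' (Ici t) t :=
    hu.mono_of_mem_nhdsWithin (Icc_mem_nhdsGE_of_mem ht)
  have := dist_le_of_approx_trajectories_ODE_of_mem (v := f₀) (K := L) (s := fun _ => univ)
    (εf := d) (εg := 0) (δ := d)
    (fun t ht => (hf₀ t (Ico_subset_Icc_self ht)).lipschitzOnWith)
    (fun t ht => (hu₁ t ht).continuousWithinAt)
    (fun t ht => hright ht (hu₁ t (Ico_subset_Icc_self ht)))
    (fun t ht => hf t (Ico_subset_Icc_self ht)) (fun _ _ => mem_univ _)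
    (fun t ht => (hu₀ t ht).continuousWithinAt)
    (fun t ht => hright ht (hu₀ t (Ico_subset_Icc_self ht)))
    (fun t _ => (dist_self _).le) (fun _ _ => mem_univ _) h0 t ht
  have hL' : (L : ℝ) ≠ 0 := by exact_mod_cast hL.ne'
  rw [Real.dist_eq, add_zero, sub_zero, gronwallBound_of_K_ne_0 hL'] at this
  refine this.trans ?_
  have hexp : Real.exp (L * t) ≤ Real.exp (L * T) := by
    gcongr
    exact ht.2
  have h1 : d / L * (Real.exp (L * t) - 1) ≤ d / L * (Real.exp (L * T) - 1) := by gcongr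
  have h2 : d * Real.exp (L * t) ≤ d * Real.exp (L * T) := by gcongr
  calc _ ≤ d * Real.exp (L * T) + d / L * (Real.exp (L * T) - 1) := add_le_add h2 h1
    _ = d * gronwallFactor L T := by unfold gronwallFactor; ring

/-- Global existence for a bounded, Lipschitz continuous scalar equation. -/
theorem exists_hasDerivWithinAt_of_lipschitzWith {T : ℝ} (hT : 0 ≤ T) {f : ℝ → ℝ → ℝ}
    {L M : NNReal} (hf : ∀ t ∈ Icc 0 T, LipschitzWith L (f t))
    (hfc : ∀ z, ContinuousOn (fun t => f t z) (Icc 0 T)) (hM : ∀ t ∈ Icc 0 T, ∀ z, |f t z| ≤ M)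
    (c : ℝ) : ∃ u : ℝ → ℝ, u 0 = c ∧
      ∀ t ∈ Icc 0 T, HasDerivWithinAt u (f t (u t)) (Icc 0 T) t := by
  -- With speed at most `M`, a trajectory stays in the ball of radius `M * T` around `c` up to time
  -- `T`, so the local theorem covers all of `[0, T]`.
  have h : IsPicardLindelof f (tmin := 0) (tmax := T) ⟨0, le_rfl, hT⟩ c (M * T.toNNReal) 0 M L :=
    { lipschitzOnWith := fun t ht => (hf t ht).lipschitzOnWith
      continuousOn := fun z _ => hfc z
      norm_le := fun t ht z _ => hM t ht z
      mul_max_le := by simp [hT] }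
  exact h.exists_eq_forall_mem_Icc_hasDerivWithinAt₀

variable {T : ℝ}

/-! ### Uniform bounds from compactness of a fundamental domain. -/

section Bounds

theorem SmoothCircle.apply_fract (k : SmoothCircle) (ξ : ℝ) : k (Int.fract ξ) = k ξ := by
  have hk : Function.Periodic (k : ℝ → ℝ) 1 := k.periodic
  have := hk.sub_zsmul_eq (x := ξ) ⌊ξ⌋
  rwa [zsmul_one] at this

theorem SmoothNonlinearity.apply_fract (φ : SmoothNonlinearity T) (t η z : ℝ) :
    φ (t, Int.fract η, z) = φ (t, η, z) := by
  have hk : Function.Periodic (fun η => φ (t, η, z)) 1 := fun η => by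
    simpa using φ.periodic (t, η, z)
  have := hk.sub_zsmul_eq (x := η) ⌊η⌋
  rwa [zsmul_one] at this

/-- A fundamental domain of the set of points of the slab with `|z| ≤ R`. -/
def slabBox (T R : ℝ) : Set (ℝ × ℝ × ℝ) := Icc 0 T ×ˢ Icc 0 1 ×ˢ Icc (-R) R

theorem isCompact_slabBox (T R : ℝ) : IsCompact (slabBox T R) :=
  isCompact_Icc.prod (isCompact_Icc.prod isCompact_Icc)

theorem slabBox_subset (T R : ℝ) : slabBox T R ⊆ slab T := fun _ hq => mem_slab.2 hq.1

theorem fract_mem_slabBox {R t η z : ℝ} (ht : t ∈ Icc 0 T) (hz : z ∈ Icc (-R) R) :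
    (t, Int.fract η, z) ∈ slabBox T R :=
  ⟨ht, ⟨Int.fract_nonneg _, (Int.fract_lt_one _).le⟩, hz⟩

theorem SmoothNonlinearity.exists_bound (φ : SmoothNonlinearity T) (R : ℝ) :
    ∃ M : NNReal, ∀ t ∈ Icc 0 T, ∀ η, ∀ z ∈ Icc (-R) R, |φ (t, η, z)| ≤ M := by
  obtain ⟨M, hM⟩ := (isCompact_slabBox T R).exists_bound_of_continuousOn
    (φ.continuousOn.mono (slabBox_subset T R))
  refine ⟨M.toNNReal, fun t ht η z hz => ?_⟩
  rw [← φ.apply_fract]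
  exact (hM _ (fract_mem_slabBox ht hz)).trans (Real.le_coe_toNNReal M)

variable [hT : Fact (0 < T)]

theorem SmoothSpace.eventually_abs_sub_lt {V : Type} [NormedAddCommGroup V] [NormedSpace ℝ V]
    {Q : Set V} {p : V} [Fact (UniqueDiffOn ℝ Q)] (f : SmoothSpace Q p) {K : Set V}
    (hK : IsCompact K) (hKQ : K ⊆ Q) {ε : ℝ} (hε : 0 < ε) :
    ∀ᶠ g in 𝓝 f, ∀ q ∈ K, |g q - f q| < ε := by
  filter_upwards [(SmoothSpace.withSeminorms.tendsto_nhds id f).1 tendsto_id (0, ⟨K, hK, hKQ⟩) ε hε]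
    with g hg q hq
  have := (g - f).norm_iteratedFDerivWithin_le_seminorm 0 hK hKQ hq
  rw [norm_iteratedFDerivWithin_zero] at this
  exact this.trans_lt hg

theorem SmoothNonlinearity.exists_lipschitz (φ : SmoothNonlinearity T) (R : ℝ) :
    ∃ L : NNReal, 0 < L ∧ ∀ t ∈ Icc 0 T, ∀ η, ∀ z ∈ Icc (-R) R, ∀ z' ∈ Icc (-R) R,
      |φ (t, η, z) - φ (t, η, z')| ≤ L * |z - z'| := by
  obtain ⟨M, hM⟩ := (partialState φ).exists_bound R
  -- The summand 1 makes the constant positive, as `gronwallFactor` divides by it.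
  refine ⟨M + 1, by positivity, fun t ht η z hz z' hz' => ?_⟩
  have h := φ.sub_eq_mul_integral_dirDeriv (q := (t, η, z')) (e := (0, 0, 1))
    (fun s => mem_slab.2 (by simpa using ht)) (z - z')
  simp only [Prod.smul_mk, Prod.mk_add_mk, mul_zero, add_zero, smul_eq_mul, mul_one,
    add_sub_cancel] at h
  rw [h, abs_mul, mul_comm]
  refine mul_le_mul_of_nonneg_right ?_ (abs_nonneg _)
  have h2 := MeasureTheory.norm_integral_le_of_norm_le_const (μ := MeasureTheory.volume) (C := M)
    (f := fun σ : unitInterval => partialState φ (t, η, z' + σ * (z - z')))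
    (Eventually.of_forall fun σ => hM t ht η _ ?_)
  · rw [Real.norm_eq_abs, MeasureTheory.probReal_univ, mul_one] at h2
    refine h2.trans ?_
    push_cast
    linarith
  · have := (convex_Icc (-R) R).add_smul_sub_mem hz' hz σ.2
    simpa using this

end Bounds

/-- The field of the transport equation along the characteristic issuing from `ξ`, modified to be
constant in `z` for `z ≤ -R` and for `R ≤ z`. -/
def clampedField (φ : SmoothNonlinearity T) (R ξ t z : ℝ) : ℝ := φ (t, ξ + t, max (-R) (min z R))

theorem clamp_mem {R : ℝ} (hR : 0 ≤ R) (z : ℝ) : max (-R) (min z R) ∈ Icc (-R) R :=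
  ⟨le_max_left _ _, max_le (by linarith) (min_le_right _ _)⟩

theorem clamp_of_abs_le {R z : ℝ} (hz : |z| ≤ R) : max (-R) (min z R) = z := by
  rw [min_eq_left (abs_le.1 hz).2, max_eq_right (abs_le.1 hz).1]

theorem abs_clamp_sub_le (R z z' : ℝ) :
    |max (-R) (min z R) - max (-R) (min z' R)| ≤ |z - z'| :=
  (abs_max_sub_max_le_max _ _ _ _).trans (by
    rw [sub_self, abs_zero, max_eq_right (abs_nonneg _)]
    refine (abs_min_sub_min_le_max _ _ _ _).trans ?_
    rw [sub_self, abs_zero, max_eq_left (abs_nonneg _)])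

theorem continuousOn_clampedField (φ : SmoothNonlinearity T) (R : ℝ) :
    ContinuousOn (fun p : ℝ × ℝ × ℝ => clampedField φ R p.1 p.2.1 p.2.2)
      (univ ×ˢ Icc 0 T ×ˢ univ) :=
  φ.continuousOn.comp
    (f := fun p : ℝ × ℝ × ℝ => (p.2.1, p.1 + p.2.1, max (-R) (min p.2.2 R)))
    (by fun_prop) fun _ hp => mem_slab.2 hp.2.1

theorem lipschitzWith_clampedField {φ : SmoothNonlinearity T} {R : ℝ} (hR : 0 ≤ R) {L : NNReal}
    (hL : ∀ t ∈ Icc 0 T, ∀ η, ∀ z ∈ Icc (-R) R, ∀ z' ∈ Icc (-R) R,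
      |φ (t, η, z) - φ (t, η, z')| ≤ L * |z - z'|) (ξ : ℝ) {t : ℝ} (ht : t ∈ Icc 0 T) :
    LipschitzWith L (clampedField φ R ξ t) :=
  LipschitzWith.of_dist_le_mul fun z z' =>
    (hL t ht _ _ (clamp_mem hR z) _ (clamp_mem hR z')).trans (by
      gcongr
      exact abs_clamp_sub_le R z z')

variable [hT : Fact (0 < T)]

theorem exists_clamped_solution (φ : SmoothNonlinearity T) {R : ℝ} (hR : 0 ≤ R) (c ξ : ℝ) :
    ∃ u : ℝ → ℝ, u 0 = c ∧
      ∀ t ∈ Icc 0 T, HasDerivWithinAt u (clampedField φ R ξ t (u t)) (Icc 0 T) t := by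
  obtain ⟨L, -, hL⟩ := φ.exists_lipschitz R
  obtain ⟨M, hM⟩ := φ.exists_bound R
  refine exists_hasDerivWithinAt_of_lipschitzWith hT.out.le
    (fun t ht => lipschitzWith_clampedField hR hL ξ ht) (fun z => ?_)
    (fun t ht z => hM t ht _ _ (clamp_mem hR z)) c
  exact (continuousOn_clampedField φ R).comp (f := fun t => (ξ, t, z)) (by fun_prop)
    fun t ht => ⟨mem_univ _, ht, mem_univ _⟩

/-- The solutions of the modified equation along the characteristics depend continuously on the
characteristic. -/
theorem continuousOn_of_clamped_solutions {k : SmoothCircle} {φ : SmoothNonlinearity T} {R : ℝ}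
    (hR : 0 ≤ R) {u : ℝ → ℝ → ℝ} (hu0 : ∀ ξ, u ξ 0 = k ξ)
    (hu : ∀ ξ, ∀ t ∈ Icc 0 T,
      HasDerivWithinAt (u ξ) (clampedField φ R ξ t (u ξ t)) (Icc 0 T) t) :
    ContinuousOn (fun q : ℝ × ℝ => u (q.2 - q.1) q.1) (strip T) := by
  obtain ⟨L, hL0, hL⟩ := φ.exists_lipschitz R
  have hC := gronwallFactor_pos (L := L) (T := T) (by exact_mod_cast hL0) hT.out.le
  set C := gronwallFactor L T with hCdef
  intro q hq
  rw [ContinuousWithinAt, Metric.tendsto_nhds]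
  intro ε hε
  -- Gronwall's estimate gives `d * C = ε / 2`; the other half is for the variation in time along
  -- the fixed characteristic.
  set d := ε / (2 * C) with hd
  have hd0 : 0 < d := by positivity
  have h1 : ∀ᶠ ξ in 𝓝 (q.2 - q.1), ∀ p ∈ Icc 0 T ×ˢ Icc (-R) R,
      |clampedField φ R ξ p.1 p.2 - clampedField φ R (q.2 - q.1) p.1 p.2| < d := by
    have hcomp : IsCompact (Icc 0 T ×ˢ Icc (-R) R : Set (ℝ × ℝ)) :=
      isCompact_Icc.prod isCompact_Icc
    have := isCompact_iff_compactSpace.1 hcomp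
    have hc : Continuous fun z : ℝ × (Icc 0 T ×ˢ Icc (-R) R : Set (ℝ × ℝ)) =>
        clampedField φ R z.1 z.2.1.1 z.2.1.2 :=
      (continuousOn_clampedField φ R).comp_continuous
        (f := fun z : ℝ × (Icc 0 T ×ˢ Icc (-R) R : Set (ℝ × ℝ)) => (z.1, z.2.1.1, z.2.1.2))
        (by fun_prop) fun z => ⟨mem_univ _, z.2.2.1, mem_univ _⟩
    have hc2 : Continuous fun z : ℝ × (Icc 0 T ×ˢ Icc (-R) R : Set (ℝ × ℝ)) =>
        |clampedField φ R z.1 z.2.1.1 z.2.1.2 -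
          clampedField φ R (q.2 - q.1) z.2.1.1 z.2.1.2| := by
      refine (hc.sub ?_).abs
      exact hc.comp (f := fun z : ℝ × (Icc 0 T ×ˢ Icc (-R) R : Set (ℝ × ℝ)) =>
        (q.2 - q.1, z.2)) (by fun_prop)
    have h2 := isCompact_univ.eventually_forall_of_forall_eventually
      (K := (univ : Set (Icc 0 T ×ˢ Icc (-R) R : Set (ℝ × ℝ)))) (x₀ := q.2 - q.1)
      (P := fun ξ p => |clampedField φ R ξ p.1.1 p.1.2 -
        clampedField φ R (q.2 - q.1) p.1.1 p.1.2| < d)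
      fun p _ => hc2.continuousAt.eventually (gt_mem_nhds (by simpa using hd0))
    filter_upwards [h2] with ξ hξ p hp using hξ ⟨p, hp⟩ (mem_univ _)
  have h2 : ∀ᶠ ξ in 𝓝 (q.2 - q.1), |k ξ - k (q.2 - q.1)| < d :=
    Metric.tendsto_nhds.1 ((continuousOn_univ.1 k.continuousOn).tendsto _) d hd0
  have hξ : Tendsto (fun p : ℝ × ℝ => p.2 - p.1) (𝓝[strip T] q) (𝓝 (q.2 - q.1)) :=
    (continuous_snd.sub continuous_fst).continuousWithinAt
  have hfst : Tendsto (fun p : ℝ × ℝ => p.1) (𝓝[strip T] q) (𝓝[Icc 0 T] q.1) :=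
    continuous_fst.continuousWithinAt.tendsto_nhdsWithin fun p hp => hp.1
  have h3 : ∀ᶠ t in 𝓝[Icc 0 T] q.1, dist (u (q.2 - q.1) t) (u (q.2 - q.1) q.1) < ε / 2 :=
    Metric.tendsto_nhds.1 (hu (q.2 - q.1) q.1 hq.1).continuousWithinAt.tendsto _ (half_pos hε)
  filter_upwards [hξ.eventually h1, hξ.eventually h2, hfst.eventually h3, self_mem_nhdsWithin]
    with p hp1 hp2 hp3 hpT
  refine (dist_triangle _ (u (q.2 - q.1) p.1) _).trans_lt ?_
  rw [← add_halves ε]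
  refine add_lt_add_of_le_of_lt ?_ hp3
  have hest := abs_sub_le_mul_gronwallFactor hL0 hd0.le
    (fun t ht => lipschitzWith_clampedField hR hL (q.2 - q.1) ht) (hu (q.2 - q.1))
    (hu (p.2 - p.1)) (fun t ht => ?_) ?_ hpT.1
  · rw [Real.dist_eq]
    refine hest.trans (le_of_eq ?_)
    rw [hd, ← hCdef]
    field_simp
  -- The fields were compared for `|z| ≤ R` only; this suffices because clamping is idempotent.
  · have := (hp1 (t, max (-R) (min (u (p.2 - p.1) t) R)) ⟨ht, clamp_mem hR _⟩).le
    simpa only [clampedField, clamp_of_abs_le (abs_le.2 (clamp_mem hR _))] using this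
  · rw [hu0, hu0]
    exact hp2.le

/-- The translate by one period solves the same problem, so uniqueness applies. -/
theorem IsTransportSolution.periodic {k : SmoothCircle} {φ : SmoothNonlinearity T}
    {y : ℝ × ℝ → ℝ} (h : IsTransportSolution k φ y) {q : ℝ × ℝ} (hq : q ∈ strip T) :
    y (q + (0, 1)) = y q := by
  refine h.eqOn (y₂ := fun q => y (q + (0, 1))) ⟨?_, fun q hq => ?_⟩ hq
  · exact h.1.comp (f := fun q : ℝ × ℝ => q + (0, 1)) (by fun_prop)
      fun q hq => mem_strip.2 (by simpa using hq.1)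
  · have h1 := h.2 (q.1, q.2 + 1) (mem_strip.2 hq.1)
    rw [charIntegral_shift] at h1
    have h2 : k (q.2 + 1 - q.1) = k (q.2 - q.1) := by
      rw [← k.periodic (q.2 - q.1), add_sub_right_comm]
    have h3 : (fun r : ℝ × ℝ => φ (r.1, r.2 + 1, y (r.1, r.2 + 1))) =
        fun r => φ (r.1, r.2, y (r + (0, 1))) := by
      funext r
      have h4 : r + (0, 1) = (r.1, r.2 + 1) := by ext <;> simp
      have h5 := φ.periodic (r.1, r.2, y (r.1, r.2 + 1))
      rw [h4, ← h5]
      simp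
    have h4 : q + (0, 1) = (q.1, q.2 + 1) := by ext <;> simp
    simp only [h2, h3] at h1
    simp only
    rw [h4, h1]

theorem IsTransportSolution.exists_bound {k : SmoothCircle} {φ : SmoothNonlinearity T}
    {y : ℝ × ℝ → ℝ} (h : IsTransportSolution k φ y) : ∃ R, 0 ≤ R ∧ ∀ q ∈ strip T, |y q| ≤ R := by
  have hK : IsCompact (Icc 0 T ×ˢ Icc 0 1 : Set (ℝ × ℝ)) := isCompact_Icc.prod isCompact_Icc
  obtain ⟨R, hR⟩ := hK.exists_bound_of_continuousOn (h.1.mono fun q hq => mem_strip.2 hq.1)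
  have hb : ∀ q ∈ strip T, |y q| ≤ R := fun q hq => by
    have hper : Function.Periodic (fun η => y (q.1, η)) 1 := fun η => by
      simpa using h.periodic (q := (q.1, η)) (mem_strip.2 hq.1)
    have h1 := hper.sub_zsmul_eq (x := q.2) ⌊q.2⌋
    rw [zsmul_one] at h1
    have h2 : y (q.1, Int.fract q.2) = y q := h1
    rw [← h2]
    exact hR (q.1, Int.fract q.2) ⟨hq.1, Int.fract_nonneg _, (Int.fract_lt_one _).le⟩
  obtain ⟨q, hq⟩ := strip_nonempty T
  exact ⟨R, (abs_nonneg _).trans (hb q hq), hb⟩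

omit hT in
theorem isTransportSolution_of_hasDerivWithinAt {k : SmoothCircle} {φ : SmoothNonlinearity T}
    {u : ℝ → ℝ → ℝ} (hc : ContinuousOn (fun q : ℝ × ℝ => u (q.2 - q.1) q.1) (strip T))
    (hu0 : ∀ ξ, u ξ 0 = k ξ) (hu : ∀ ξ, ∀ t ∈ Icc 0 T,
      HasDerivWithinAt (u ξ) (φ (t, ξ + t, u ξ t)) (Icc 0 T) t) :
    IsTransportSolution k φ fun q => u (q.2 - q.1) q.1 := by
  refine ⟨hc, fun q hq => ?_⟩
  have h1 := (hc.superposition φ).comp_characteristic (q.2 - q.1)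
  simp only [add_sub_cancel_right] at h1
  have hsub : Icc 0 q.1 ⊆ Icc 0 T := Icc_subset_Icc_right hq.1.2
  have h2 := intervalIntegral.integral_eq_sub_of_hasDerivAt_of_le hq.1.1
    (f := u (q.2 - q.1)) (f' := fun τ => φ (τ, q.2 - q.1 + τ, u (q.2 - q.1) τ))
    (fun t ht => ((hu _ t (hsub ht)).mono hsub).continuousWithinAt)
    (fun t ht => (hu _ t (hsub (Ioo_subset_Icc_self ht))).hasDerivAt
      (Icc_mem_nhds ht.1 (ht.2.trans_le hq.1.2)))
    (ContinuousOn.intervalIntegrable (by rw [uIcc_of_le hq.1.1]; exact h1.mono hsub))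
  rw [hu0] at h2
  have h3 := charIntegral_eq_intervalIntegral
    (fun r => φ (r.1, r.2, u (r.2 - r.1) r.1)) q.1 q.2
  simp only [add_sub_cancel_right] at h3
  rw [h3, h2]
  ring

/-- If a transport equation is solvable, then so are all nearby ones, with nearby solutions. -/
theorem IsTransportSolution.eventually_exists {x₀ : SmoothCircle × SmoothNonlinearity T}
    {y₀ : ℝ × ℝ → ℝ} (h : IsTransportSolution x₀.1 x₀.2 y₀) {ε : ℝ} (hε : 0 < ε) :
    ∀ᶠ x in 𝓝 x₀, ∃ y, IsTransportSolution x.1 x.2 y ∧ ∀ q ∈ strip T, |y q - y₀ q| ≤ ε := by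
  obtain ⟨R₀, hR₀, hy₀⟩ := h.exists_bound
  -- Whatever stays within `ε` of `y₀` is bounded by `R`, hence unaffected by the truncation.
  set R := R₀ + ε with hRdef
  have hR : 0 ≤ R := by positivity
  obtain ⟨L, hL0, hL⟩ := x₀.2.exists_lipschitz R
  have hC := gronwallFactor_pos (L := L) (T := T) (by exact_mod_cast hL0) hT.out.le
  set d := ε / gronwallFactor L T with hd
  have hd0 : 0 < d := by positivity
  have hk := (continuous_fst.tendsto x₀).eventually
    (x₀.1.eventually_abs_sub_lt (isCompact_Icc (a := (0 : ℝ)) (b := 1)) (subset_univ _) hd0)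
  have hφ := (continuous_snd.tendsto x₀).eventually
    (x₀.2.eventually_abs_sub_lt (isCompact_slabBox T R) (slabBox_subset T R) hd0)
  filter_upwards [hk, hφ] with x hxk hxφ
  choose u hu0 hu using fun ξ => exists_clamped_solution x.2 hR (x.1 ξ) ξ
  -- `y₀` solves the truncated equation of `x₀`, whose Lipschitz constant is fixed; `u ξ` solves the
  -- truncated equation of `x`, a perturbation of size at most `d`.
  have hclose : ∀ ξ, ∀ t ∈ Icc 0 T, |u ξ t - y₀ (t, ξ + t)| ≤ ε := fun ξ t ht => by
    have hv : ∀ t ∈ Icc 0 T, HasDerivWithinAt (fun t => y₀ (t, ξ + t))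
        (clampedField x₀.2 R ξ t (y₀ (t, ξ + t))) (Icc 0 T) t := fun t ht => by
      rw [clampedField, clamp_of_abs_le ((hy₀ _ (mem_strip.2 ht)).trans (by linarith))]
      refine hasDerivWithinAt_Icc_of_eq_integral (c := x₀.1 ξ)
        (g := fun t => x₀.2 (t, ξ + t, y₀ (t, ξ + t)))
        ((h.1.superposition x₀.2).comp_characteristic ξ) (fun t ht => ?_) ht
      rw [h.2 _ (mem_strip.2 ht), charIntegral_eq_intervalIntegral]
      simp only [add_sub_cancel_right]
    have := abs_sub_le_mul_gronwallFactor hL0 hd0.le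
      (fun t ht => lipschitzWith_clampedField hR hL ξ ht) hv (hu ξ) (fun t ht => ?_) ?_ ht
    · rwa [hd, div_mul_cancel₀ _ hC.ne'] at this
    · rw [clampedField, clampedField, ← x.2.apply_fract, ← x₀.2.apply_fract]
      exact (hxφ _ (fract_mem_slabBox ht (clamp_mem hR _))).le
    · have h0 := h.2 (0, ξ) (mem_strip.2 ⟨le_rfl, hT.out.le⟩)
      rw [charIntegral_eq_intervalIntegral, intervalIntegral.integral_same, add_zero] at h0
      simp only [sub_zero] at h0
      rw [hu0, add_zero, h0, ← SmoothCircle.apply_fract x.1, ← SmoothCircle.apply_fract x₀.1]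
      exact (hxk _ ⟨Int.fract_nonneg _, (Int.fract_lt_one _).le⟩).le
  have hc := continuousOn_of_clamped_solutions hR hu0 hu
  refine ⟨_, isTransportSolution_of_hasDerivWithinAt hc hu0 fun ξ t ht => ?_, fun q hq => ?_⟩
  · have h1 := hu ξ t ht
    have h2 : |u ξ t| ≤ R := by
      have := abs_sub_abs_le_abs_sub (u ξ t) (y₀ (t, ξ + t))
      have := hclose ξ t ht
      have := hy₀ (t, ξ + t) (mem_strip.2 ht)
      linarith
    rwa [clampedField, clamp_of_abs_le h2] at h1
  · have := hclose (q.2 - q.1) q.1 hq.1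
    rwa [sub_add_cancel] at this

end

noncomputable section

/-! The solution operator of the transport equation. -/

theorem mem_solutionRelation_iff {T : ℝ} {x : SmoothCircle × SmoothNonlinearity T}
    {y : C1Cylinder T} :
    (x, y) ∈ solutionRelation T ↔ IsTransportSolution x.1 x.2 (y : ℝ × ℝ → ℝ) := by
  refine ⟨fun h => ⟨y.2.1.continuousOn, fun q hq => ?_⟩, fun h t ht η => ?_⟩
  · exact (h q.1 hq.1 q.2).trans
      (congrArg _ (charIntegral_eq_intervalIntegral (fun r => x.2 (r.1, r.2, y.1 r)) q.1 q.2).symm)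
  · exact (h.2 (t, η) (mem_strip.2 ht)).trans
      (congrArg _ (charIntegral_eq_intervalIntegral (fun r => x.2 (r.1, r.2, y.1 r)) t η))

variable {T : ℝ} [hT : Fact (0 < T)]

omit hT in
theorem IsTransportSolution.congr {k : SmoothCircle} {φ : SmoothNonlinearity T}
    {y y' : ℝ × ℝ → ℝ} (h : IsTransportSolution k φ y) (hy : EqOn y' y (strip T)) :
    IsTransportSolution k φ y' := by
  refine ⟨h.1.congr hy, fun q hq => ?_⟩
  rw [hy hq, h.2 q hq]
  congr 1
  exact charIntegral_congr (fun r hr => by rw [hy hr]) hq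

theorem IsTransportSolution.exists_smooth {k : SmoothCircle} {φ : SmoothNonlinearity T}
    {y : ℝ × ℝ → ℝ} (h : IsTransportSolution k φ y) :
    ∃ Y : SmoothCylinder T, ∀ q ∈ strip T, Y q = y q := by
  obtain ⟨Y, -, hY⟩ := SmoothSpace.exists_continuous_of_contDiffFamilyOn (Q := strip T)
    (p := ((0, 1) : ℝ × ℝ)) (g := fun _ : Unit => y)
    (fun m => contDiffFamilyOn_of_isTransportSolution (k := fun _ => k) (φ := fun _ => φ)
      continuous_const continuous_const (fun _ => h)
      (h.1.comp continuousOn_snd fun _ hz => hz.2) m)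
    fun _ q hq => h.periodic hq
  exact ⟨Y (), hY ()⟩

/-- The set of all data for which the transport equation is solvable. -/
def solvableSet (T : ℝ) : Set (SmoothCircle × SmoothNonlinearity T) :=
  {x | ∃ y, IsTransportSolution x.1 x.2 y}

theorem isOpen_solvableSet : IsOpen (solvableSet T) := by
  refine isOpen_iff_mem_nhds.2 fun x ⟨y, hy⟩ => ?_
  filter_upwards [hy.eventually_exists one_pos] with x' ⟨y', hy', _⟩ using ⟨y', hy'⟩

open Classical in
/-- The solution operator of the transport equation. -/
def solutionMap (x : SmoothCircle × SmoothNonlinearity T) : SmoothCylinder T :=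
  if hx : x ∈ solvableSet T then hx.choose_spec.exists_smooth.choose else 0

theorem isTransportSolution_solutionMap {x : SmoothCircle × SmoothNonlinearity T}
    (hx : x ∈ solvableSet T) : IsTransportSolution x.1 x.2 (solutionMap x : ℝ × ℝ → ℝ) := by
  rw [solutionMap, dif_pos hx]
  exact hx.choose_spec.congr hx.choose_spec.exists_smooth.choose_spec

theorem IsTransportSolution.eq_solutionMap {x : SmoothCircle × SmoothNonlinearity T}
    {y : SmoothCylinder T} (h : IsTransportSolution x.1 x.2 (y : ℝ × ℝ → ℝ)) :
    y = solutionMap x :=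
  SmoothSpace.ext fun _ hq => (isTransportSolution_solutionMap ⟨_, h⟩).eqOn h hq

/-- Stability and uniqueness give uniform closeness of the solutions, hence joint continuity;
`contDiffFamilyOn_of_isTransportSolution` extends this to all derivatives. -/
theorem continuousOn_solutionMap : ContinuousOn (solutionMap (T := T)) (solvableSet T) := by
  rw [continuousOn_iff_continuous_domRestrict]
  refine SmoothSpace.continuous_of_contDiffFamilyOn fun m =>
    contDiffFamilyOn_of_isTransportSolution (X := solvableSet T) (k := fun x => x.1.1)
      (φ := fun x => x.1.2) (by fun_prop) (by fun_prop)
      (fun x => isTransportSolution_solutionMap x.2) ?_ m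
  rintro ⟨x, q⟩ hz
  have hq : q ∈ strip T := hz.2
  rw [ContinuousWithinAt, nhdsWithin_prod_eq, nhdsWithin_univ, Metric.tendsto_nhds]
  intro ε hε
  have h1 : ∀ᶠ x' : solvableSet T in 𝓝 x, ∀ q ∈ strip T,
      |solutionMap x'.1 q - solutionMap x.1 q| ≤ ε / 2 := by
    filter_upwards [(continuous_subtype_val.tendsto x).eventually
      ((isTransportSolution_solutionMap x.2).eventually_exists (half_pos hε))]
      with x' ⟨y, hy, hyx⟩ q hq
    rw [(hy.eqOn (isTransportSolution_solutionMap x'.2)) hq]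
    exact hyx q hq
  have h2 : ∀ᶠ r in 𝓝[strip T] q, dist (solutionMap x.1 r) (solutionMap x.1 q) < ε / 2 :=
    Metric.tendsto_nhds.1 ((solutionMap x.1).continuousOn q hq) _ (half_pos hε)
  filter_upwards [h1.prod_mk (h2.and self_mem_nhdsWithin)] with z ⟨hz1, hz2, hz3⟩
  refine (dist_triangle _ (solutionMap x.1 z.2) _).trans_lt ?_
  rw [← add_halves ε]
  exact add_lt_add_of_le_of_lt (hz1 _ hz3) hz2

-- The quotient is a `linSol` containing `solutionMap` at `x` and at `x + t • h` but no quotient of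
-- it, which closes the induction.
open SmoothCylinder in
theorem quotDiffOn_solutionMap (n : ℕ) :
    QuotDiffOn n (solutionMap (T := T)) (solvableSet T) := by
  induction n with
  | zero => exact continuousOn_solutionMap
  | succ n ih =>
    refine ⟨continuousOn_solutionMap, fun z => linSol z.2.1.1
      (slope z.1.2 (solutionMap z.1) (solutionMap (z.1 + z.2.2 • z.2.1)))
      (superpose (z.2.1.2, solutionMap (z.1 + z.2.2 • z.2.1))), ?_,
      fun x h t hx hxt => SmoothSpace.ext fun q hq => ?_⟩
    · have h1 : QuotDiffOn n (fun z : (SmoothCircle × SmoothNonlinearity T) ×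
          (SmoothCircle × SmoothNonlinearity T) × ℝ => z) (quotDomain (solvableSet T)) :=
        QuotDiffOn.id
      have h2 := ih.comp h1.fst fun z hz => hz.1
      have h3 := ih.comp_add_smul
      exact quotDiffOn_linSol h1.snd.fst.fst (quotDiffOn_slope h1.fst.snd h2 h3)
        (quotDiffOn_superpose h1.snd.fst.snd h3)
    · have h2 := isTransportSolution_solutionMap hxt
      have h3 := (isTransportSolution_solutionMap hx).sub_eq_linSolution h2.1
        (h2.1.superposition _) h2.2 hq
      have h4 := linSolution_congr (T := T) (k := fun ξ => (x + t • h).1 ξ - x.1 ξ)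
        (k' := fun ξ => t * h.1 ξ) (a := meanSlope x.2 (solutionMap x) (solutionMap (x + t • h)))
        (a' := slope x.2 (solutionMap x) (solutionMap (x + t • h)))
        (b := fun r => (x + t • h).2 (r.1, r.2, solutionMap (x + t • h) r) -
          x.2 (r.1, r.2, solutionMap (x + t • h) r))
        (b' := fun r => t * superpose (h.2, solutionMap (x + t • h)) r)
        (fun ξ => by
          simp only [Prod.fst_add, Prod.smul_fst, SmoothSpace.add_apply, SmoothSpace.smul_apply]
          ring) (fun r hr => (slope_apply _ _ _ hr).symm)
        (fun r hr => by
          simp only [Prod.snd_add, Prod.smul_snd, SmoothSpace.add_apply, SmoothSpace.smul_apply,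
            superpose_apply _ hr]
          ring) hq
      rw [h4, linSolution_const_mul, ← linSol_apply _ _ _ hq] at h3
      rw [SmoothSpace.add_apply, SmoothSpace.smul_apply, ← h3]
      ring

end

theorem theorem5p8 (T : ℝ) [Fact (0 < T)] :
    -- every `C^1` solution is smooth, that is, the relation is contained in `E × F`
    (∀ w ∈ solutionRelation T, ∃ y : SmoothCylinder T, y.toC1 = w.2) ∧
    -- as a subset of `E × F`, it is a Keller smooth map
    IsKellerSmooth
      {w : (SmoothCircle × SmoothNonlinearity T) × SmoothCylinder T |
        (w.1, w.2.toC1) ∈ solutionRelation T} ∧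
    -- its domain is open
    IsOpen {x : SmoothCircle × SmoothNonlinearity T |
      ∃ y : C1Cylinder T, (x, y) ∈ solutionRelation T} := by
  refine ⟨fun w hw => ?_, ?_, ?_⟩
  · obtain ⟨Y, hY⟩ := (mem_solutionRelation_iff.1 hw).exists_smooth
    refine ⟨Y, Subtype.ext (funext fun q => ?_)⟩
    by_cases hq : q ∈ strip T
    · exact hY q hq
    · exact (Y.2.2.1 q hq).trans (w.2.2.2.1 q hq).symm
  · convert isKellerSmooth_of_quotDiffOn isOpen_solvableSet (quotDiffOn_solutionMap (T := T))
      using 1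
    ext w
    refine mem_solutionRelation_iff.trans ⟨fun h => ⟨⟨_, h⟩, h.eq_solutionMap⟩, fun h => ?_⟩
    change IsTransportSolution w.1.1 w.1.2 (w.2 : ℝ × ℝ → ℝ)
    rw [h.2]
    exact isTransportSolution_solutionMap h.1
  · convert isOpen_solvableSet (T := T) using 1
    ext x
    refine ⟨fun ⟨y, hy⟩ => ⟨_, mem_solutionRelation_iff.1 hy⟩, fun hx => ?_⟩
    exact ⟨(solutionMap x).toC1, mem_solutionRelation_iff.2 (isTransportSolution_solutionMap hx)⟩
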